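/- **The Ewald form of the periodic Coulomb energy.** Let $l_1,l_2,l_3\in\mathbb R^3$ be linearly independent and let $V=|l_1\cdot(l_2\times l_3)|$ be the volume of the unit cell that they span. For $n,m\in\mathbb Z^3$ put $L_n=\sum_t n_t l_t$ and $G_m=\sum_t m_t k_t$, where $k_t=2\pi\,\dfrac{l_{t+1}\times l_{t+2}}{l_t\cdot(l_{t+1}\times l_{t+2})}$ (indices modulo $3$) are the reciprocal lattice vectors. Let ions with charges $q_1,\dots,q_N\in\mathbb R$, $\sum_i q_i=0$, be placed at $r_1,\dots,r_N\in\mathbb R^3$, no two of them differing by a lattice vector $L_n$. Put $r_{ij}=r_i-r_j$ and $r_{i,j,n}=r_i+L_n-r_j$, let $k_e\in\mathbb R$ be the Coulomb constant, and let $\sum'_{i,j,n}$ denote the sum over all $i,j\in\{1,\dots,N\}$ and $n\in\mathbb Z^3$ without the terms with $i=j$ and $n=0$. The Coulomb energy $$\Phi_{Coul}=\frac{k_e}{2}\sideset{}{'}\sum_{i,j,n}\frac{q_iq_j}{\|r_{i,j,n}\|}$$ is a series that is not absolutely convergent; its value is understood as the Abel sum $$\Phi_{Coul}=\lim_{\varepsilon\to0^+}\frac{k_e}{2}\sideset{}{'}\sum_{i,j,n}q_iq_j\frac{e^{-\varepsilon\|r_{i,j,n}\|}}{\|r_{i,j,n}\|}.$$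 Then, for every $\alpha>0$, the series $$\Phi^S_{Coul}=k_e\sideset{}{'}\sum_{i,j,n}q_iq_j\frac{\operatorname{erfc}(\alpha\|r_{i,j,n}\|)}{2\|r_{i,j,n}\|},\qquad \Phi^L_{Coul}=k_e\sum_{i,j=1}^N\sum_{m\in\mathbb Z^3\setminus\{0\}}q_iq_j\frac{2\pi}{V\|G_m\|^2}\exp\!\left(-\frac{\|G_m\|^2}{4\alpha^2}\right)\cos(G_m\cdot r_{ij})$$ converge absolutely; the series with the factor $e^{-\varepsilon\|r_{i,j,n}\|}$ converges absolutely for every $\varepsilon>0$, and the limit that defines $\Phi_{Coul}$ exists; and with $$\Phi^{self}_{Coul}=-k_e\frac{\alpha}{\sqrt\pi}\sum_{i=1}^N q_i^2$$ one has $$\Phi_{Coul}=\Phi^S_{Coul}+\Phi^L_{Coul}+\Phi^{self}_{Coul}.$$ If moreover $\sum_i q_i r_i=0$, then the Coulomb series itself, without convergence factor and summed cell by cell, i.e. $\sum_{n\in\mathbb Z^3}\Bigl(\frac{k_e}{2}\sum'_{i,j}\frac{q_iq_j}{\|r_{i,j,n}\|}\Bigr)$ with the terms $i=j$ left out for $n=0$,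 converges absolutely, as a series over $n$, to $\Phi_{Coul}$. -/

import Mathlib

open Filter Topology

noncomputable section

namespace Ewald

/-- Euclidean three-space. -/
abbrev Space := EuclideanSpace ℝ (Fin 3)

/-- The error function `erf z = (2/√π) ∫₀ᶻ exp(-t²) dt`. -/
def erf (z : ℝ) : ℝ := 2 / Real.sqrt Real.pi * ∫ t in (0 : ℝ)..z, Real.exp (-t ^ 2)

/-- The complementary error function. -/
def erfc (z : ℝ) : ℝ := 1 - erf z

/-- The vector product of Euclidean three-space. -/
def cross (u v : Space) : Space := WithLp.toLp 2 (crossProduct u.ofLp v.ofLp)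

/-- The triple product `u · (v × w)`. -/
def triple (u v w : Space) : ℝ := inner ℝ u (cross v w)

/-- The integer combination `n₁ b₁ + n₂ b₂ + n₃ b₃` of the vectors `b`. With `b` the lattice
vectors `l` this is the translation `L_n`, with `b` the reciprocal vectors it is `G_m`. -/
def comb (b : Fin 3 → Space) (n : Fin 3 → ℤ) : Space := ∑ t, (n t : ℝ) • b t

/-- The reciprocal lattice vectors
`k_t = 2π (l_{t+1} × l_{t+2}) / (l_t · (l_{t+1} × l_{t+2}))`, indices modulo three. -/
def recip (l : Fin 3 → Space) (t : Fin 3) : Space :=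
  (2 * Real.pi / triple (l t) (l (t + 1)) (l (t + 2))) • cross (l (t + 1)) (l (t + 2))

/-- The volume of the unit cell, the parallelepiped spanned by `l`. -/
def cellVolume (l : Fin 3 → Space) : ℝ := |triple (l 0) (l 1) (l 2)|

variable {N : ℕ}

/-- The separation vector `r_{i,j,n} = r_i + L_n - r_j`. -/
def sep (l : Fin 3 → Space) (r : Fin N → Space) (i j : Fin N) (n : Fin 3 → ℤ) : Space :=
  r i + comb l n - r j

/-- The contribution `q_i q_j v(‖r_{i,j,n}‖)` of the pair formed by ion `i` and the image `n` of
ion `j` under the radial pair potential `v`. An ion does not interact with itself: the terms with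
`i = j` and `n = 0` are left out. -/
def pairTerm (v : ℝ → ℝ) (q : Fin N → ℝ) (l : Fin 3 → Space) (r : Fin N → Space)
    (i j : Fin N) (n : Fin 3 → ℤ) : ℝ :=
  if i = j ∧ n = 0 then 0 else q i * q j * v ‖sep l r i j n‖

/-- The term of index `m` of the reciprocal-space sum of the pair `i, j`; the term with `m = 0` is
left out. -/
def recipTerm (α : ℝ) (q : Fin N → ℝ) (l : Fin 3 → Space) (r : Fin N → Space)
    (i j : Fin N) (m : Fin 3 → ℤ) : ℝ :=
  if m = 0 then 0 else
    q i * q j * (2 * Real.pi / (cellVolume l * ‖comb (recip l) m‖ ^ 2)) *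
      Real.exp (-‖comb (recip l) m‖ ^ 2 / (4 * α ^ 2)) *
      Real.cos (inner ℝ (comb (recip l) m) (r i - r j))

/-- The part of the Coulomb energy due to the pairs of ions `i` of the central cell and `j` of
the cell with index `n`. -/
def cellCoulomb (ke : ℝ) (q : Fin N → ℝ) (l : Fin 3 → Space) (r : Fin N → Space)
    (n : Fin 3 → ℤ) : ℝ :=
  ke / 2 * ∑ i, ∑ j, pairTerm (fun d => 1 / d) q l r i j n

/-- The Coulomb series with the convergence factor `exp(-ε ‖r_{i,j,n}‖)` in each of its terms. -/
def abelCoulomb (ke : ℝ) (q : Fin N → ℝ) (l : Fin 3 → Space) (r : Fin N → Space) (ε : ℝ) : ℝ :=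
  ke / 2 * ∑ i, ∑ j, ∑' n, pairTerm (fun d => Real.exp (-ε * d) / d) q l r i j n

/-- The Coulomb energy `Φ_Coul = (k_e/2) ∑'_{i,j} ∑_n q_i q_j / ‖r_{i,j,n}‖`. The series is not
absolutely convergent; its value is its Abel sum, the limit as `ε → 0⁺` of the series with the
convergence factor `exp(-ε ‖r_{i,j,n}‖)`. -/
def coulombEnergy (ke : ℝ) (q : Fin N → ℝ) (l : Fin 3 → Space) (r : Fin N → Space) : ℝ :=
  limUnder (𝓝[>] (0 : ℝ)) (abelCoulomb ke q l r)

/-- The real-space, short-range part of the Ewald form. -/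
def shortEnergy (ke α : ℝ) (q : Fin N → ℝ) (l : Fin 3 → Space) (r : Fin N → Space) : ℝ :=
  ke * ∑ i, ∑ j, ∑' n, pairTerm (fun d => erfc (α * d) / (2 * d)) q l r i j n

/-- The reciprocal-space, long-range part of the Ewald form. -/
def longEnergy (ke α : ℝ) (q : Fin N → ℝ) (l : Fin 3 → Space) (r : Fin N → Space) : ℝ :=
  ke * ∑ i, ∑ j, ∑' m, recipTerm α q l r i j m

/-- The self term of the Ewald form. -/
def selfEnergy (ke α : ℝ) (q : Fin N → ℝ) : ℝ :=
  -ke * ∑ i, q i ^ 2 * (α / Real.sqrt Real.pi)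

end Ewald

end

/-!
The screened Coulomb potential is a mixture of Gaussians,
`exp(-ε d) / d = (2 / √π) ∫₀^∞ exp(-t² d²) exp(-ε² / (4 t²)) dt` (`Ewald.integral_mixture`), and the
Ewald form comes from cutting this integral at `t = α`.

* The part `t > α` is, for `ε = 0`, the potential `erfc(α d) / d`. It is `O(d⁻⁴)` uniformly in `ε`,
  so the limit `ε → 0` can be taken under its lattice sum.
* The part `t ≤ α` is summed over *all* lattice translations, the excluded self interaction
  included, by integrating the Poisson formula for a Gaussian (`Ewald.hasSum_gaussian_comb`,
  `Ewald.hasSum_screenedRecip`). The reciprocal vector `G_m` contributes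
  `4π / (V (‖G_m‖² + ε²)) exp(-(‖G_m‖² + ε²) / (4α²)) cos(G_m · z)`. The term `m = 0`, which diverges
  as `ε → 0`, does not depend on the pair of ions, so it vanishes for every `ε > 0` in a neutral
  cell; the other terms converge, dominated by their values at `ε = 0` without the cosine.
* Taking the self interaction out again costs `∑ qᵢ²` times the value at distance `0` of the part
  `t ≤ α`, which tends to `2α / √π`: this is the self term.

The Poisson formula itself is the Fourier series on the torus `(ℝ/ℤ)³` of the sum over the integer
translates of a function, in coordinates with respect to the lattice vectors.

If charge and dipole moment vanish, then in `∑ qᵢ qⱼ exp(-t² ‖rᵢ - rⱼ + L‖²)` the expansion in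
`rᵢ - rⱼ` has no terms of order up to two. Integrated over `t` this bounds the energy of the cell at
`L` by a multiple of `‖L‖⁻⁴`, uniformly in `ε` (`Ewald.summable_cellBound`). So the series over cells
converges absolutely, and the limit `ε → 0` may be taken termwise.
-/

namespace Ewald
open MeasureTheory Set

/-! ### Lattice and reciprocal lattice -/

section Lattice

variable {l : Fin 3 → Space}

lemma inner_cross (u v w : Space) : inner ℝ u (cross v w) =
    u 0 * (v 1 * w 2 - v 2 * w 1) + u 1 * (v 2 * w 0 - v 0 * w 2)
      + u 2 * (v 0 * w 1 - v 1 * w 0) := by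
  simp [cross, cross_apply, PiLp.inner_apply, Fin.sum_univ_three]
  ring

lemma triple_eq_det (l : Fin 3 → Space) :
    triple (l 0) (l 1) (l 2) = (Matrix.of fun i j => l i j).det := by
  rw [triple, inner_cross, Matrix.det_fin_three]
  simp
  ring

lemma triple_ne_zero (hl : LinearIndependent ℝ l) : triple (l 0) (l 1) (l 2) ≠ 0 := by
  rw [triple_eq_det]
  have h : LinearIndependent ℝ (fun i => (l i).ofLp) :=
    hl.map' (WithLp.linearEquiv 2 ℝ (Fin 3 → ℝ)).toLinearMap (LinearEquiv.ker _)
  have := Matrix.linearIndependent_rows_iff_isUnit.mp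
    (show LinearIndependent ℝ (Matrix.of fun i j => l i j).row from h)
  exact ((Matrix.isUnit_iff_isUnit_det _).mp this).ne_zero

lemma cellVolume_pos (hl : LinearIndependent ℝ l) : 0 < cellVolume l :=
  abs_pos.mpr (triple_ne_zero hl)

/-- The reciprocal vectors are dual to the lattice vectors, up to the factor `2π`. -/
lemma inner_recip (hl : LinearIndependent ℝ l) (i j : Fin 3) :
    inner ℝ (recip l i) (l j) = if i = j then 2 * Real.pi else 0 := by
  have h0 := triple_ne_zero hl
  have h1 : triple (l 1) (l 2) (l 0) = triple (l 0) (l 1) (l 2) := by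
    simp only [triple, inner_cross]; ring
  have h2 : triple (l 2) (l 0) (l 1) = triple (l 0) (l 1) (l 2) := by
    simp only [triple, inner_cross]; ring
  rw [recip, real_inner_comm, inner_smul_right]
  have hc : inner ℝ (l j) (cross (l (i + 1)) (l (i + 2)))
      = if i = j then triple (l 0) (l 1) (l 2) else 0 := by
    fin_cases i <;> fin_cases j <;> simp [triple, inner_cross] <;> ring
  have ht : triple (l i) (l (i + 1)) (l (i + 2)) = triple (l 0) (l 1) (l 2) := by
    fin_cases i <;> simp [h1, h2]
  rw [hc, ht]
  split_ifs
  · field_simp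
  · simp

lemma linearIndependent_recip (hl : LinearIndependent ℝ l) : LinearIndependent ℝ (recip l) := by
  rw [Fintype.linearIndependent_iff]
  intro c hc i
  have h : inner ℝ (∑ k, c k • recip l k) (l i) = 0 := by rw [hc, inner_zero_left]
  simpa [sum_inner, inner_smul_left, inner_recip hl, Real.pi_ne_zero] using h

lemma comb_injective (hl : LinearIndependent ℝ l) : Function.Injective (comb l) := by
  intro n m h
  have h' := (Fintype.linearIndependent_iff.mp hl) (fun t => (n t : ℝ) - m t) (by
    simp only [sub_smul, Finset.sum_sub_distrib]
    exact sub_eq_zero.mpr h)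
  ext t
  exact_mod_cast sub_eq_zero.mp (h' t)

@[simp] lemma comb_zero (l : Fin 3 → Space) : comb l 0 = 0 := by simp [comb]

lemma comb_ne_zero (hl : LinearIndependent ℝ l) {n : Fin 3 → ℤ} (hn : n ≠ 0) : comb l n ≠ 0 :=
  fun h => hn (comb_injective hl (h.trans (comb_zero l).symm))

/-- The convergence of all lattice sums is reduced to that of the inverse fourth powers, the exponent
`4` being above the dimension. -/
lemma summable_inv_pow_four (hl : LinearIndependent ℝ l) (z : Space) :
    Summable fun n : Fin 3 → ℤ => (‖z + comb l n‖⁻¹) ^ 4 := by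
  let b := basisOfLinearIndependentOfCardEqFinrank hl (by simp)
  have hb : ⇑b = l := coe_basisOfLinearIndependentOfCardEqFinrank hl (by simp)
  let L := Submodule.span ℤ (Set.range b)
  have hL : Module.finrank ℤ L < 4 := by
    rw [finrank_span_eq_card (b.linearIndependent.restrict_scalars
      (by simpa using Int.cast_injective))]
    simp
  have hmem (n : Fin 3 → ℤ) : comb l n ∈ L := by
    refine Submodule.sum_mem _ fun t _ => ?_
    rw [Int.cast_smul_eq_zsmul]
    exact Submodule.smul_mem _ _ (Submodule.subset_span ⟨t, by rw [hb]⟩)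
  have := (ZLattice.summable_norm_sub_inv_pow L 4 hL (-z)).comp_injective
    (i := fun n : Fin 3 → ℤ => (⟨comb l n, hmem n⟩ : L))
    fun n m h => comb_injective hl (congrArg Subtype.val h)
  refine this.congr fun n => ?_
  simp [add_comm]

lemma tendsto_norm_comb (hl : LinearIndependent ℝ l) :
    Tendsto (fun n : Fin 3 → ℤ => ‖comb l n‖) cofinite atTop := by
  have h := (summable_inv_pow_four hl 0).tendsto_cofinite_zero
  refine tendsto_atTop.mpr fun B => ?_
  have hpos : 0 < ((max B 1)⁻¹) ^ 4 := by positivity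
  have hne : ∀ᶠ n : Fin 3 → ℤ in cofinite, n ≠ 0 := by simp [Filter.eventually_cofinite]
  filter_upwards [h.eventually_lt_const hpos, hne] with n hn h0
  have hn' := lt_of_pow_lt_pow_left₀ 4 (by positivity) hn
  rw [zero_add] at hn'
  exact (le_max_left B 1).trans
    ((inv_lt_inv₀ (norm_pos_iff.mpr (comb_ne_zero hl h0)) (by positivity)).mp hn').le

lemma summable_exp_neg_norm_sq (hl : LinearIndependent ℝ l) {c : ℝ} (hc : 0 < c) (z : Space) :
    Summable fun n : Fin 3 → ℤ => Real.exp (-c * ‖z + comb l n‖ ^ 2) := by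
  refine Summable.of_norm_bounded_eventually
    ((summable_inv_pow_four hl z).mul_left (2 / c ^ 2)) ?_
  have hlarge := (tendsto_norm_comb hl).eventually_gt_atTop ‖z‖
  filter_upwards [hlarge] with n hn
  have hd : 0 < ‖z + comb l n‖ := by
    rw [norm_pos_iff]
    intro h
    rw [eq_neg_of_add_eq_zero_right h, norm_neg] at hn
    exact lt_irrefl _ hn
  rw [Real.norm_of_nonneg (Real.exp_pos _).le, neg_mul, Real.exp_neg]
  have := Real.pow_div_factorial_le_exp (c * ‖z + comb l n‖ ^ 2) (by positivity) 2
  rw [show 2 / c ^ 2 * ‖z + comb l n‖⁻¹ ^ 4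
    = ((c * ‖z + comb l n‖ ^ 2) ^ 2 / (Nat.factorial 2 : ℝ))⁻¹ by
      rw [show (Nat.factorial 2 : ℝ) = 2 by norm_num [Nat.factorial]]; field_simp]
  exact inv_anti₀ (by positivity) this

end Lattice

/-! ### Poisson summation in several variables -/

section Poisson

open UnitAddTorus TopologicalSpace

variable {d : Type*} [Fintype d]

/-- The integral over `ℝᵈ` is the sum of the integrals over the integer translates of the half-open
unit cube, moved back to that cube. -/
lemma hasSum_integral_unitCube {g : (d → ℝ) → ℂ} (hg : Integrable g) :
    HasSum (fun n : d → ℤ => ∫ x in {x : d → ℝ | ∀ i, x i ∈ Ioc (0 : ℝ) (0 + 1)},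
      g (x + fun i => (n i : ℝ))) (∫ x, g x) := by
  let s : (d → ℤ) → Set (d → ℝ) := fun n => {x | ∀ i, x i ∈ Ioc (n i : ℝ) (n i + 1)}
  have hceil {n : d → ℤ} {x : d → ℝ} : x ∈ s n ↔ ∀ i, ⌈x i⌉ = n i + 1 := by
    refine forall_congr' fun i => ?_
    rw [Int.ceil_eq_iff]
    simp
  have hmeas (n) : MeasurableSet (s n) := MeasurableSet.univ_pi' fun i => measurableSet_Ioc
  have hdisj : Pairwise (Function.onFun Disjoint s) := by
    intro n m hnm
    refine Set.disjoint_left.mpr fun x hx hx' => hnm (funext fun i => ?_)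
    have h1 := hceil.mp hx i
    have h2 := hceil.mp hx' i
    omega
  have huniv : ⋃ n, s n = univ := by
    refine eq_univ_of_forall fun x => mem_iUnion.mpr ⟨fun i => ⌈x i⌉ - 1, hceil.mpr fun i => ?_⟩
    ring
  have h := hasSum_integral_iUnion hmeas hdisj (hg.integrableOn (s := ⋃ n, s n))
  rw [huniv, setIntegral_univ] at h
  refine h.congr_fun fun n => ?_
  rw [← (measurePreserving_add_right volume (fun i => (n i : ℝ))).setIntegral_preimage_emb
    (measurableEmbedding_addRight _) g (s n)]
  congr 2
  ext x
  simp [s]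
  grind

/-- Poisson summation: an integrable continuous function on `ℝᵈ` whose integer translates are
locally uniformly summable and whose Fourier transform is summable over `ℤᵈ` has the same sum over
`ℤᵈ` as its Fourier transform. -/
theorem hasSum_integral_mFourier_mul (f : C(d → ℝ, ℂ)) (hf : Integrable f)
    (hK : ∀ K : Compacts (d → ℝ), Summable fun n : d → ℤ =>
      ‖(f.comp (ContinuousMap.addRight fun i => (n i : ℝ))).restrict K‖)
    (hs : Summable fun m : d → ℤ =>
      ∫ x : d → ℝ, mFourier (-m) (fun i => (x i : UnitAddCircle)) * f x) :
    HasSum (fun m : d → ℤ =>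
      ∫ x : d → ℝ, mFourier (-m) (fun i => (x i : UnitAddCircle)) * f x)
      (∑' n : d → ℤ, f fun i => (n i : ℝ)) := by
  let π : C(d → ℝ, UnitAddTorus d) :=
    ⟨Pi.map fun _ => ((↑) : ℝ → UnitAddCircle), by
      exact (IsOpenQuotientMap.piMap fun _ => QuotientAddGroup.isOpenQuotientMap_mk).continuous⟩
  have hπ : IsQuotientMap π :=
    (IsOpenQuotientMap.piMap fun _ => QuotientAddGroup.isOpenQuotientMap_mk).isQuotientMap
  let T : (d → ℤ) → C(d → ℝ, ℂ) := fun n => f.comp (ContinuousMap.addRight fun i => (n i : ℝ))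
  have hT : Summable T := ContinuousMap.summable_of_locally_summable_norm hK
  let S : C(d → ℝ, ℂ) := ∑' n, T n
  have hS (x : d → ℝ) : S x = ∑' n : d → ℤ, f (x + fun i => (n i : ℝ)) :=
    (ContinuousMap.tsum_apply hT x).symm
  have hper : Function.FactorsThrough S π := by
    intro x y hxy
    have h (i) : ∃ k : ℤ, y i + k = x i := by
      have hi : (x i : UnitAddCircle) = y i := congrFun hxy i
      obtain ⟨k, hk⟩ := (QuotientAddGroup.eq_iff_sub_mem.mp hi)
      refine ⟨k, ?_⟩
      simp only [zsmul_eq_mul, mul_one] at hk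
      linarith
    choose k hk using h
    rw [hS, hS, ← (Equiv.addLeft k).tsum_eq fun n : d → ℤ => f (y + fun i => (n i : ℝ))]
    refine tsum_congr fun n => congrArg f (funext fun i => ?_)
    simp only [Pi.add_apply, Equiv.coe_addLeft, Int.cast_add, ← hk]
    ring
  let F : C(UnitAddTorus d, ℂ) := hπ.lift S hper
  have hF (x : d → ℝ) : F (π x) = S x := DFunLike.congr_fun (hπ.lift_comp S hper) x
  have hcoeff (m : d → ℤ) : mFourierCoeff F m =
      ∫ x : d → ℝ, mFourier (-m) (fun i => (x i : UnitAddCircle)) * f x := by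
    let e : (d → ℝ) → ℂ := fun x => mFourier (-m) (π x)
    have he (x : d → ℝ) (n : d → ℤ) : e (x + fun i => (n i : ℝ)) = e x := by
      refine congrArg (mFourier (-m)) (funext fun i => ?_)
      simp [π]
    have hec : Continuous e := (mFourier (-m)).continuous.comp π.continuous
    have hen (x) : ‖e x‖ = 1 := by
      simp only [e, mFourier, ContinuousMap.coe_mk, norm_prod]
      exact Finset.prod_eq_one fun i _ => Circle.norm_coe _
    have hef : Integrable fun x => e x * f x :=
      hf.bdd_mul (c := 1) hec.aestronglyMeasurable (.of_forall fun x => (hen x).le)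
    rw [mFourierCoeff_eq_integral F m 0]
    have h1 := hasSum_integral_unitCube hef
    -- Applied to the norm, the decomposition into cubes shows that sum and integral commute.
    have h2 := (hasSum_integral_unitCube hef.norm.ofReal).summable
    have h3 := hasSum_integral_of_summable_integral_norm
      (μ := volume.restrict {x : d → ℝ | ∀ i, x i ∈ Ioc (0 : ℝ) (0 + 1)})
      (F := fun (n : d → ℤ) x => e (x + fun i => (n i : ℝ)) * f (x + fun i => (n i : ℝ)))
      (fun n => (hef.comp_add_right _).integrableOn) (by
        simp only [integral_ofReal] at h2
        exact Complex.summable_ofReal.mp h2)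
    rw [show (∫ x : d → ℝ, mFourier (-m) (fun i => (x i : UnitAddCircle)) * f x)
      = ∫ x, e x * f x from rfl, ← h3.unique h1]
    refine integral_congr_ae (.of_forall fun x => ?_)
    change e x * F (π x) = _
    simp only [hF, hS, he]
    exact tsum_mul_left.symm
  have hsum : Summable (mFourierCoeff F) := by simpa only [funext hcoeff] using hs
  have h := hasSum_mFourier_series_apply_of_summable hsum (π 0)
  rw [hF, hS] at h
  have h0 (m : d → ℤ) : mFourier m (π 0) = 1 := by
    simp [mFourier, π]
  simpa [h0, hcoeff] using h

end Poisson

/-! ### Poisson summation of a Gaussian over a lattice -/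

section Gaussian

open UnitAddTorus TopologicalSpace

variable {l : Fin 3 → Space}

/-- The linear isomorphism that maps coordinates with respect to `l` to points of space. -/
noncomputable def coordEquiv (hl : LinearIndependent ℝ l) : (Fin 3 → ℝ) ≃L[ℝ] Space :=
  (basisOfLinearIndependentOfCardEqFinrank hl (by simp)).equivFun.symm.toContinuousLinearEquiv

lemma coordEquiv_apply (hl : LinearIndependent ℝ l) (x : Fin 3 → ℝ) :
    coordEquiv hl x = ∑ t, x t • l t := by
  simp [coordEquiv, Module.Basis.equivFun_symm_apply]

lemma coordEquiv_intCast (hl : LinearIndependent ℝ l) (n : Fin 3 → ℤ) :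
    coordEquiv hl (fun i => (n i : ℝ)) = comb l n := coordEquiv_apply hl _

/-- In coordinates, the plane waves of the reciprocal lattice are the characters of the torus. -/
lemma inner_comb_recip_coordEquiv (hl : LinearIndependent ℝ l) (m : Fin 3 → ℤ) (x : Fin 3 → ℝ) :
    inner ℝ (comb (recip l) m) (coordEquiv hl x) = 2 * Real.pi * ∑ i, m i * x i := by
  rw [coordEquiv_apply, comb]
  simp only [sum_inner, inner_sum, inner_smul_left, inner_smul_right, inner_recip hl]
  simp [Finset.mul_sum]
  refine Finset.sum_congr rfl fun i _ => ?_
  ring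

/-- The coordinate map scales volumes by the volume of the unit cell. -/
lemma map_coordEquiv (hl : LinearIndependent ℝ l) :
    Measure.map (coordEquiv hl) volume = ENNReal.ofReal (cellVolume l)⁻¹ • volume := by
  let M : Matrix (Fin 3) (Fin 3) ℝ := (Matrix.of fun i j => l i j).transpose
  have hdet : M.det = triple (l 0) (l 1) (l 2) := by rw [Matrix.det_transpose, triple_eq_det]
  have hM : M.det ≠ 0 := hdet ▸ triple_ne_zero hl
  have hmap : ⇑(coordEquiv hl) = WithLp.toLp 2 ∘ Matrix.toLin' M := by
    ext x i
    simp [coordEquiv_apply, M, Matrix.mulVec, dotProduct, mul_comm]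
  have hmeas : Measurable (Matrix.toLin' M) := by
    have h := (WithLp.measurable_ofLp 2 (Fin 3 → ℝ)).comp (coordEquiv hl).continuous.measurable
    rwa [hmap] at h
  rw [hmap, ← Measure.map_map (WithLp.measurable_toLp 2 _) hmeas,
    Real.map_matrix_volume_pi_eq_smul_volume_pi hM, Measure.map_smul,
    (PiLp.volume_preserving_toLp (Fin 3)).map_eq, hdet, abs_inv, ← cellVolume]

lemma integral_comp_coordEquiv (hl : LinearIndependent ℝ l) (g : Space → ℂ) :
    ∫ x, g (coordEquiv hl x) = ((cellVolume l)⁻¹ : ℝ) * ∫ y, g y := by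
  have h := (coordEquiv hl).toHomeomorph.measurableEmbedding.integral_map (μ := volume) g
  refine h.symm.trans ?_
  change ∫ y, g y ∂(Measure.map (coordEquiv hl) volume) = _
  have hV : 0 ≤ (cellVolume l)⁻¹ := inv_nonneg.mpr (cellVolume_pos hl).le
  rw [map_coordEquiv, integral_smul_measure, ENNReal.toReal_ofReal hV, Complex.real_smul]

lemma integrable_comp_coordEquiv (hl : LinearIndependent ℝ l) {g : Space → ℂ}
    (hg : Integrable g) : Integrable fun x => g (coordEquiv hl x) := by
  refine ((coordEquiv hl).toHomeomorph.measurableEmbedding.integrable_map_iff).mp ?_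
  change Integrable g (Measure.map (coordEquiv hl) volume)
  rw [map_coordEquiv]
  exact hg.smul_measure ENNReal.ofReal_ne_top

lemma mFourier_coe (m : Fin 3 → ℤ) (x : Fin 3 → ℝ) :
    mFourier m (fun i => (x i : UnitAddCircle))
      = Complex.exp (2 * Real.pi * Complex.I * ∑ i, (m i : ℂ) * x i) := by
  simp only [mFourier, ContinuousMap.coe_mk, fourier_coe_apply, ← Complex.exp_sum]
  congr 1
  rw [Finset.mul_sum]
  refine Finset.sum_congr rfl fun i _ => ?_
  push_cast
  ring

/-- The Fourier transform of a Gaussian centred at `-z`, in lattice coordinates. -/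
lemma integral_mFourier_mul_gaussian (hl : LinearIndependent ℝ l) {t : ℝ} (ht : 0 < t)
    (z : Space) (m : Fin 3 → ℤ) :
    ∫ x : Fin 3 → ℝ, mFourier (-m) (fun i => (x i : UnitAddCircle)) *
        (Real.exp (-t ^ 2 * ‖z + coordEquiv hl x‖ ^ 2) : ℂ)
      = (Real.pi ^ (3 / 2 : ℝ) / (cellVolume l * t ^ 3) *
          Real.exp (-‖comb (recip l) m‖ ^ 2 / (4 * t ^ 2)) : ℝ) *
        Complex.exp (Complex.I * (inner ℝ (comb (recip l) m) z : ℝ)) := by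
  set G := comb (recip l) m with hG
  have h1 (x : Fin 3 → ℝ) : mFourier (-m) (fun i => (x i : UnitAddCircle)) *
        (Real.exp (-t ^ 2 * ‖z + coordEquiv hl x‖ ^ 2) : ℂ)
      = (fun y : Space => Complex.exp (-Complex.I * (inner ℝ G y : ℝ)) *
        (Real.exp (-t ^ 2 * ‖z + y‖ ^ 2) : ℂ)) (coordEquiv hl x) := by
    simp only [mFourier_coe, hG, inner_comb_recip_coordEquiv]
    congr 2
    push_cast [Pi.neg_apply]
    simp only [neg_mul, Finset.sum_neg_distrib]
    ring
  have h2 (y : Space) : Complex.exp (-Complex.I * (inner ℝ G (y - z) : ℝ)) *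
        (Real.exp (-t ^ 2 * ‖z + (y - z)‖ ^ 2) : ℂ)
      = Complex.exp (Complex.I * (inner ℝ G z : ℝ)) *
        Complex.exp (-(t ^ 2 : ℝ) * ‖y‖ ^ 2 + (-Complex.I) * (inner ℝ G y : ℝ)) := by
    rw [add_sub_cancel, inner_sub_right, Complex.ofReal_exp, ← Complex.exp_add, ← Complex.exp_add]
    congr 1
    push_cast
    ring
  simp_rw [h1]
  rw [integral_comp_coordEquiv hl (fun y : Space => Complex.exp (-Complex.I * (inner ℝ G y : ℝ)) *
        (Real.exp (-t ^ 2 * ‖z + y‖ ^ 2) : ℂ)), ← integral_sub_right_eq_self _ z]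
  simp_rw [h2]
  have ht2 : 0 < ((t ^ 2 : ℝ) : ℂ).re := by rw [Complex.ofReal_re]; positivity
  rw [integral_const_mul, GaussianFourier.integral_cexp_neg_mul_sq_norm_add ht2]
  have h3 : ((Real.pi : ℂ) / ((t ^ 2 : ℝ) : ℂ)) ^ ((Module.finrank ℝ Space : ℂ) / 2)
      = ((Real.pi ^ (3 / 2 : ℝ) / t ^ 3 : ℝ) : ℂ) := by
    rw [finrank_euclideanSpace_fin, ← Complex.ofReal_div,
      show (((3 : ℕ) : ℂ) / 2) = ((3 / 2 : ℝ) : ℂ) by push_cast; rfl,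
      ← Complex.ofReal_cpow (by positivity), Real.div_rpow Real.pi_pos.le (by positivity),
      ← Real.rpow_natCast t 2, ← Real.rpow_mul ht.le]
    norm_num
  rw [h3, neg_sq, Complex.I_sq]
  push_cast
  have h4 : -1 * (‖G‖ : ℂ) ^ 2 / (4 * t ^ 2) = -‖G‖ ^ 2 / (4 * t ^ 2) := by ring
  rw [h4]
  have := (cellVolume_pos hl).ne'
  field_simp

/-- Poisson summation of the Gaussian `exp(-t² ‖·‖²)` over a translate of the lattice. -/
theorem hasSum_gaussian_comb (hl : LinearIndependent ℝ l) {t : ℝ} (ht : 0 < t) (z : Space) :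
    HasSum (fun m : Fin 3 → ℤ => Real.pi ^ (3 / 2 : ℝ) / (cellVolume l * t ^ 3) *
        Real.exp (-‖comb (recip l) m‖ ^ 2 / (4 * t ^ 2)) *
        Real.cos (inner ℝ (comb (recip l) m) z))
      (∑' n : Fin 3 → ℤ, Real.exp (-t ^ 2 * ‖z + comb l n‖ ^ 2)) := by
  let f : C(Fin 3 → ℝ, ℂ) :=
    ⟨fun x => (Real.exp (-t ^ 2 * ‖z + coordEquiv hl x‖ ^ 2) : ℂ), by fun_prop⟩
  have hsum : Summable fun m : Fin 3 → ℤ =>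
      Real.exp (-‖comb (recip l) m‖ ^ 2 / (4 * t ^ 2)) := by
    refine (summable_exp_neg_norm_sq (linearIndependent_recip hl)
      (c := 1 / (4 * t ^ 2)) (by positivity) 0).congr fun m => ?_
    rw [zero_add]
    congr 1
    ring
  have h := hasSum_integral_mFourier_mul f ?_ ?_ ?_
  · have hre := Complex.hasSum_re h
    have hn (n : Fin 3 → ℤ) : f (fun i => (n i : ℝ))
        = (Real.exp (-t ^ 2 * ‖z + comb l n‖ ^ 2) : ℂ) := by
      simp [f, coordEquiv_intCast]
    simp_rw [hn] at hre
    rw [← Complex.ofReal_tsum, Complex.ofReal_re] at hre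
    refine hre.congr_fun fun m => ?_
    change _ = Complex.re (∫ x : Fin 3 → ℝ, mFourier (-m) (fun i => (x i : UnitAddCircle)) *
        (Real.exp (-t ^ 2 * ‖z + coordEquiv hl x‖ ^ 2) : ℂ))
    rw [integral_mFourier_mul_gaussian hl ht, Complex.re_ofReal_mul, mul_comm Complex.I,
      Complex.exp_ofReal_mul_I_re]
  · have ht2 : 0 < ((t ^ 2 : ℝ) : ℂ).re := by rw [Complex.ofReal_re]; positivity
    have hg := GaussianFourier.integrable_cexp_neg_mul_sq_norm_add ht2 0 (0 : Space)
    refine (integrable_comp_coordEquiv hl (hg.comp_add_left z)).congr (.of_forall fun x => ?_)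
    simp [f]
  · intro K
    obtain ⟨b, hb⟩ := K.isCompact.exists_bound_of_continuousOn
      (f := fun x => z + coordEquiv hl x) (by fun_prop)
    refine Summable.of_nonneg_of_le (fun n => norm_nonneg _) (fun n => ?_)
      ((summable_exp_neg_norm_sq hl (c := t ^ 2 / 2) (by positivity) 0).mul_left
        (Real.exp (t ^ 2 * b ^ 2)))
    refine (ContinuousMap.norm_le _ (by positivity)).mpr fun x => ?_
    have hx := hb x x.2
    set w := z + coordEquiv hl (x : Fin 3 → ℝ) with hw
    have hval : ((f.comp (ContinuousMap.addRight fun i => (n i : ℝ))).restrict K) x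
        = (Real.exp (-t ^ 2 * ‖w + comb l n‖ ^ 2) : ℂ) := by
      change (Real.exp (-t ^ 2 * ‖z + coordEquiv hl ((x : Fin 3 → ℝ) + fun i => (n i : ℝ))‖ ^ 2)
        : ℂ) = _
      rw [map_add, coordEquiv_intCast, hw, add_assoc]
    rw [hval, Complex.norm_real, Real.norm_of_nonneg (Real.exp_pos _).le, ← Real.exp_add, zero_add]
    refine Real.exp_le_exp.mpr ?_
    have h1 : ‖comb l n‖ ≤ ‖w + comb l n‖ + b := by
      have := norm_sub_le (w + comb l n) w
      rw [add_sub_cancel_left] at this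
      linarith
    have h2 : ‖comb l n‖ ^ 2 ≤ 2 * ‖w + comb l n‖ ^ 2 + 2 * b ^ 2 := by
      have := pow_le_pow_left₀ (norm_nonneg _) h1 2
      nlinarith [sq_nonneg (‖w + comb l n‖ - b)]
    nlinarith [sq_nonneg t]
  · refine Summable.of_norm ?_
    refine (hsum.mul_left (Real.pi ^ (3 / 2 : ℝ) / (cellVolume l * t ^ 3))).congr fun m => ?_
    change _ = ‖∫ x : Fin 3 → ℝ, mFourier (-m) (fun i => (x i : UnitAddCircle)) *
        (Real.exp (-t ^ 2 * ‖z + coordEquiv hl x‖ ^ 2) : ℂ)‖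
    have := cellVolume_pos hl
    rw [integral_mFourier_mul_gaussian hl ht, norm_mul, mul_comm Complex.I,
      Complex.norm_exp_ofReal_mul_I, mul_one, Complex.norm_real, Real.norm_of_nonneg]
    positivity

end Gaussian

/-! ### Gaussian mixtures for the screened Coulomb potential -/

section Mixture

lemma hasDerivAt_erf (z : ℝ) : HasDerivAt erf (2 / √Real.pi * Real.exp (-z ^ 2)) z := by
  have hc : Continuous fun t : ℝ => Real.exp (-t ^ 2) := by fun_prop
  exact (intervalIntegral.integral_hasDerivAt_right (hc.intervalIntegrable _ _)
    (hc.stronglyMeasurableAtFilter _ _) hc.continuousAt).const_mul _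

lemma erf_neg (z : ℝ) : erf (-z) = -erf z := by
  have h := intervalIntegral.integral_comp_neg (a := 0) (b := z) fun t : ℝ => Real.exp (-t ^ 2)
  simp only [neg_sq, neg_zero] at h
  rw [erf, erf, h, intervalIntegral.integral_symm 0 (-z)]
  ring

lemma tendsto_erf_atTop : Tendsto erf atTop (𝓝 1) := by
  have hint : IntegrableOn (fun t : ℝ => Real.exp (-t ^ 2)) (Ioi 0) := by
    simpa using (integrable_exp_neg_mul_sq one_pos).integrableOn (s := Ioi (0 : ℝ))
  have h := (intervalIntegral_tendsto_integral_Ioi 0 hint tendsto_id).const_mul (2 / √Real.pi)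
  have hval : ∫ t in Ioi (0 : ℝ), Real.exp (-t ^ 2) = √Real.pi / 2 := by
    simpa using integral_gaussian_Ioi 1
  rw [hval, show 2 / √Real.pi * (√Real.pi / 2) = 1 by
    have := Real.sqrt_pos.mpr Real.pi_pos
    field_simp] at h
  exact h

lemma tendsto_erf_atBot : Tendsto erf atBot (𝓝 (-1)) := by
  have h := (tendsto_erf_atTop.comp tendsto_neg_atBot_atTop).neg
  refine h.congr fun z => ?_
  simp [erf_neg]

/-- The Gaussian `exp(-d² t²)` with the weight `exp(-ε² / (4 t²))`. Its integral over `t > 0` is a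
multiple of the screened Coulomb potential `exp(-ε d) / d`. -/
noncomputable def mixture (ε d t : ℝ) : ℝ :=
  Real.exp (-t ^ 2 * d ^ 2) * Real.exp (-ε ^ 2 / (4 * t ^ 2))

lemma mixture_nonneg (ε d t : ℝ) : 0 ≤ mixture ε d t := by unfold mixture; positivity

lemma exp_neg_div_le_one (ε t : ℝ) : Real.exp (-ε ^ 2 / (4 * t ^ 2)) ≤ 1 := by
  rw [Real.exp_le_one_iff, neg_div]
  exact neg_nonpos.mpr (by positivity)

lemma mixture_le (ε d t : ℝ) : mixture ε d t ≤ Real.exp (-t ^ 2 * d ^ 2) :=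
  mul_le_of_le_one_right (Real.exp_pos _).le (exp_neg_div_le_one ε t)

lemma measurable_mixture (ε d : ℝ) : Measurable (mixture ε d) := by
  unfold mixture
  fun_prop

lemma integrableOn_mixture (ε : ℝ) {d : ℝ} (hd : 0 < d) (s : Set ℝ) :
    IntegrableOn (mixture ε d) s := by
  have h : Integrable fun t : ℝ => Real.exp (-t ^ 2 * d ^ 2) := by
    refine (integrable_exp_neg_mul_sq (b := d ^ 2) (by positivity)).congr (.of_forall fun t => ?_)
    ring_nf
  refine (h.mono' (measurable_mixture ε d).aestronglyMeasurable
    (.of_forall fun t => ?_)).integrableOn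
  rw [Real.norm_of_nonneg (mixture_nonneg _ _ _)]
  exact mixture_le ε d t

/-- The screened Coulomb potential is a mixture of Gaussians. For `ε > 0` the integrand has the
antiderivative
`(√π / (4 d)) (exp(ε d) erf(d t + ε / (2 t)) + exp(-ε d) erf(d t - ε / (2 t)))`. -/
theorem integral_mixture {ε d : ℝ} (hε : 0 ≤ ε) (hd : 0 < d) :
    2 / √Real.pi * ∫ t in Ioi 0, mixture ε d t = Real.exp (-ε * d) / d := by
  have hπ := Real.sqrt_pos.mpr Real.pi_pos
  rcases hε.eq_or_lt with rfl | hε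
  · have h := integral_gaussian_Ioi (d ^ 2)
    have h' : ∫ t in Ioi (0 : ℝ), mixture 0 d t = √(Real.pi / d ^ 2) / 2 := by
      rw [← h]
      refine integral_congr_ae (.of_forall fun t => ?_)
      simp [mixture, mul_comm]
    rw [h', Real.sqrt_div Real.pi_pos.le, Real.sqrt_sq hd.le]
    simp only [neg_zero, zero_mul, Real.exp_zero]
    field_simp
  let F : ℝ → ℝ := fun t => √Real.pi / (4 * d) *
    (Real.exp (ε * d) * erf (d * t + ε / 2 * t⁻¹) + Real.exp (-ε * d) * erf (d * t - ε / 2 * t⁻¹))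
  have hF (t : ℝ) (ht : t ∈ Ioi (0 : ℝ)) : HasDerivAt F (mixture ε d t) t := by
    have ht0 : t ≠ 0 := (mem_Ioi.mp ht).ne'
    have hlin : HasDerivAt (fun t : ℝ => d * t) d t := by
      simpa using (hasDerivAt_id t).const_mul d
    have hinv := (hasDerivAt_inv ht0).const_mul (ε / 2)
    have h1 := ((hasDerivAt_erf _).comp t (hlin.add hinv)).const_mul (Real.exp (ε * d))
    have h2 := ((hasDerivAt_erf _).comp t (hlin.sub hinv)).const_mul (Real.exp (-ε * d))
    refine ((h1.add h2).const_mul (√Real.pi / (4 * d))).congr_deriv ?_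
    simp only [Pi.add_apply, Pi.sub_apply]
    have e1 : Real.exp (ε * d) * Real.exp (-(d * t + ε / 2 * t⁻¹) ^ 2) = mixture ε d t := by
      rw [mixture, ← Real.exp_add, ← Real.exp_add]
      congr 1
      field_simp
      ring
    have e2 : Real.exp (-ε * d) * Real.exp (-(d * t - ε / 2 * t⁻¹) ^ 2) = mixture ε d t := by
      rw [mixture, ← Real.exp_add, ← Real.exp_add]
      congr 1
      field_simp
      ring
    calc _ = √Real.pi / (4 * d) * (2 / √Real.pi) *
          (Real.exp (ε * d) * Real.exp (-(d * t + ε / 2 * t⁻¹) ^ 2) * (d + ε / 2 * -(t ^ 2)⁻¹)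
          + Real.exp (-ε * d) * Real.exp (-(d * t - ε / 2 * t⁻¹) ^ 2)
            * (d - ε / 2 * -(t ^ 2)⁻¹)) := by ring
      _ = mixture ε d t := by
        rw [e1, e2]
        field_simp
        ring
  have hinv0 : Tendsto (fun t : ℝ => ε / 2 * t⁻¹) (𝓝[>] 0) atTop :=
    tendsto_inv_nhdsGT_zero.const_mul_atTop (by positivity)
  have hlin0 : Tendsto (fun t : ℝ => d * t) (𝓝[>] 0) (𝓝 (d * 0)) :=
    ((continuous_const_mul d).tendsto 0).mono_left nhdsWithin_le_nhds
  have h0 : Tendsto F (𝓝[>] 0)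
      (𝓝 (√Real.pi / (4 * d) * (Real.exp (ε * d) * 1 + Real.exp (-ε * d) * (-1)))) := by
    refine ((((tendsto_erf_atTop.comp (hlin0.add_atTop hinv0)).const_mul _).add
      ((tendsto_erf_atBot.comp (?_ : Tendsto _ _ atBot)).const_mul _)).const_mul _)
    simp only [sub_eq_add_neg]
    exact hlin0.add_atBot (tendsto_neg_atTop_atBot.comp hinv0)
  have hinvT : Tendsto (fun t : ℝ => ε / 2 * t⁻¹) atTop (𝓝 (ε / 2 * 0)) :=
    tendsto_inv_atTop_zero.const_mul _
  have hlinT : Tendsto (fun t : ℝ => d * t) atTop atTop := tendsto_id.const_mul_atTop hd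
  have hT : Tendsto F atTop
      (𝓝 (√Real.pi / (4 * d) * (Real.exp (ε * d) * 1 + Real.exp (-ε * d) * 1))) := by
    refine ((((tendsto_erf_atTop.comp (hlinT.atTop_add hinvT)).const_mul _).add
      ((tendsto_erf_atTop.comp (?_ : Tendsto _ _ atTop)).const_mul _)).const_mul _)
    simp only [sub_eq_add_neg]
    exact hlinT.atTop_add hinvT.neg
  have hval : ∫ t in Ioi 0, mixture ε d t
      = √Real.pi / (4 * d) * (Real.exp (ε * d) * 1 + Real.exp (-ε * d) * 1)
        - √Real.pi / (4 * d) * (Real.exp (ε * d) * 1 + Real.exp (-ε * d) * (-1)) := by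
    -- `F` has no continuous value at `0` by itself: it is extended there by its limit.
    have h := integral_Ioi_of_hasDerivAt_of_tendsto
      (f := Function.update F 0
        (√Real.pi / (4 * d) * (Real.exp (ε * d) * 1 + Real.exp (-ε * d) * (-1))))
      (continuousWithinAt_update_same.mpr (by rwa [Ici_sdiff_left]))
      (fun t ht => (hF t ht).congr_of_eventuallyEq <|
        (eventually_ne_nhds (mem_Ioi.mp ht).ne').mono fun u hu => Function.update_of_ne hu _ _)
      (integrableOn_mixture ε hd _)
      (hT.congr' <| (eventually_ne_atTop 0).mono fun u hu => (Function.update_of_ne hu _ _).symm)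
    rwa [Function.update_self] at h
  rw [hval]
  field_simp
  ring

/-- The part `t > α` of the unscreened mixture is the short-range potential of the Ewald form. -/
lemma integral_mixture_Ioi {α d : ℝ} (hd : 0 < d) :
    2 / √Real.pi * ∫ t in Ioi α, mixture 0 d t = erfc (α * d) / d := by
  have hπ := Real.sqrt_pos.mpr Real.pi_pos
  let F : ℝ → ℝ := fun t => √Real.pi / (2 * d) * erf (d * t)
  have hF (t : ℝ) : HasDerivAt F (mixture 0 d t) t := by
    have hlin : HasDerivAt (fun t : ℝ => d * t) d t := by
      simpa using (hasDerivAt_id t).const_mul d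
    refine (((hasDerivAt_erf _).comp t hlin).const_mul (√Real.pi / (2 * d))).congr_deriv ?_
    have e : Real.exp (-(d * t) ^ 2) = mixture 0 d t := by
      simp [mixture, mul_pow, mul_comm]
    rw [e]
    field_simp
  have hT : Tendsto F atTop (𝓝 (√Real.pi / (2 * d) * 1)) :=
    (tendsto_erf_atTop.comp (tendsto_id.const_mul_atTop hd)).const_mul _
  rw [integral_Ioi_of_hasDerivAt_of_tendsto' (fun t _ => hF t) (integrableOn_mixture 0 hd _) hT]
  simp only [F, erfc, mul_comm d α]
  field_simp

/-- The weight of a reciprocal vector in the long-range part of the mixture. The integrand is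
bounded near `t = 0`, and has the antiderivative `(2 / A) exp(-A / (4 t²))`. -/
lemma integral_inv_cube_mul_exp {A α : ℝ} (hA : 0 < A) (hα : 0 < α) :
    IntegrableOn (fun t : ℝ => (t ^ 3)⁻¹ * Real.exp (-A / (4 * t ^ 2))) (Ioc 0 α) ∧
    ∫ t in Ioc 0 α, (t ^ 3)⁻¹ * Real.exp (-A / (4 * t ^ 2))
      = 2 / A * Real.exp (-A / (4 * α ^ 2)) := by
  have hint : IntegrableOn (fun t : ℝ => (t ^ 3)⁻¹ * Real.exp (-A / (4 * t ^ 2))) (Ioc 0 α) := by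
    refine Measure.integrableOn_of_bounded (M := 32 * α / A ^ 2) (by simp)
      (by fun_prop) ?_
    filter_upwards [ae_restrict_mem measurableSet_Ioc] with t ht
    have ht0 : 0 < t := ht.1
    rw [Real.norm_of_nonneg (by positivity), neg_div, Real.exp_neg]
    have h := Real.pow_div_factorial_le_exp (A / (4 * t ^ 2)) (by positivity) 2
    rw [show (Nat.factorial 2 : ℝ) = 2 by norm_num [Nat.factorial]] at h
    calc (t ^ 3)⁻¹ * (Real.exp (A / (4 * t ^ 2)))⁻¹
        ≤ (t ^ 3)⁻¹ * ((A / (4 * t ^ 2)) ^ 2 / 2)⁻¹ := by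
          gcongr
      _ = 32 * t / A ^ 2 := by field_simp; norm_num
      _ ≤ 32 * α / A ^ 2 := by gcongr; exact ht.2
  refine ⟨hint, ?_⟩
  rw [← intervalIntegral.integral_of_le hα.le]
  have hF (t : ℝ) (ht : 0 < t) : HasDerivAt (fun t : ℝ => 2 / A * Real.exp (-A / (4 * t ^ 2)))
      ((t ^ 3)⁻¹ * Real.exp (-A / (4 * t ^ 2))) t := by
    have h1 : HasDerivAt (fun t : ℝ => 4 * t ^ 2) (4 * (2 * t)) t := by
      simpa using (hasDerivAt_pow 2 t).const_mul 4
    have h2 := ((h1.fun_inv (by positivity)).const_mul (-A)).exp.const_mul (2 / A)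
    refine (h2.congr_deriv ?_).congr_of_eventuallyEq (.of_forall fun t => ?_)
    · rw [← div_eq_mul_inv (-A)]
      field_simp
      norm_num
    · simp only [div_eq_mul_inv]
  have h0 : Tendsto (fun t : ℝ => 2 / A * Real.exp (-A / (4 * t ^ 2))) (𝓝[>] 0)
      (𝓝 (2 / A * 0)) := by
    refine (Real.tendsto_exp_atBot.comp ?_).const_mul _
    have h1 : Tendsto (fun t : ℝ => A / 4 * (t⁻¹) ^ 2) (𝓝[>] 0) atTop :=
      ((tendsto_pow_atTop two_ne_zero).comp tendsto_inv_nhdsGT_zero).const_mul_atTop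
        (by positivity)
    refine (tendsto_neg_atTop_atBot.comp h1).congr fun t => ?_
    simp only [Function.comp_apply]
    rw [inv_pow, div_mul_eq_div_div_swap, neg_div, neg_div, ← div_eq_mul_inv]
    ring
  have h1 := ((hF α hα).continuousAt.tendsto.mono_left (nhdsWithin_le_nhds (s := Iio α)))
  rw [intervalIntegral.integral_eq_sub_of_hasDerivAt_of_tendsto hα
    (fun t ht => hF t ht.1) ((intervalIntegrable_iff_integrableOn_Ioc_of_le hα.le).mpr hint) h0 h1]
  ring

end Mixture

/-! ### The splitting of the screened potential -/

section Splitting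

/-- The long-range part of the screened Coulomb potential: the Gaussians `exp(-t² d²)` of its
mixture with `t ≤ α`. -/
noncomputable def longPot (α ε d : ℝ) : ℝ := 2 / √Real.pi * ∫ t in Ioc 0 α, mixture ε d t

/-- The short-range part of the screened Coulomb potential: the Gaussians `exp(-t² d²)` of its
mixture with `t > α`. -/
noncomputable def shortPot (α ε d : ℝ) : ℝ := 2 / √Real.pi * ∫ t in Ioi α, mixture ε d t

variable {α ε d : ℝ}

lemma longPot_nonneg : 0 ≤ longPot α ε d :=
  mul_nonneg (by positivity) (integral_nonneg fun _ => mixture_nonneg _ _ _)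

lemma shortPot_nonneg : 0 ≤ shortPot α ε d :=
  mul_nonneg (by positivity) (integral_nonneg fun _ => mixture_nonneg _ _ _)

lemma shortPot_add_longPot (hα : 0 < α) (hε : 0 ≤ ε) (hd : 0 < d) :
    shortPot α ε d + longPot α ε d = Real.exp (-ε * d) / d := by
  rw [← integral_mixture hε hd, ← Ioc_union_Ioi_eq_Ioi hα.le,
    setIntegral_union (Set.Ioc_disjoint_Ioi_same) measurableSet_Ioi (integrableOn_mixture ε hd _)
      (integrableOn_mixture ε hd _), shortPot, longPot]
  ring

lemma shortPot_zero (hd : 0 < d) : shortPot α 0 d = erfc (α * d) / d := integral_mixture_Ioi hd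

lemma screened_le (hε : 0 < ε) (hd : 0 < d) :
    Real.exp (-ε * d) / d ≤ 6 / ε ^ 3 * d⁻¹ ^ 4 := by
  have h := Real.pow_div_factorial_le_exp (ε * d) (by positivity) 3
  rw [show (Nat.factorial 3 : ℝ) = 6 by norm_num [Nat.factorial]] at h
  rw [neg_mul, Real.exp_neg]
  calc (Real.exp (ε * d))⁻¹ / d ≤ ((ε * d) ^ 3 / 6)⁻¹ / d := by gcongr
    _ = 6 / ε ^ 3 * d⁻¹ ^ 4 := by field_simp

lemma longPot_le (hα : 0 < α) (hε : 0 < ε) (hd : 0 < d) :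
    longPot α ε d ≤ 6 / ε ^ 3 * d⁻¹ ^ 4 :=
  (le_add_of_nonneg_left shortPot_nonneg).trans
    ((shortPot_add_longPot hα hε.le hd).le.trans (screened_le hε hd))

/-- The short-range part decays like `d⁻⁴`, uniformly in the screening: on `t > α` the Gaussian is
at most `2 / (t d)⁴`. -/
lemma exists_shortPot_le (hα : 0 < α) :
    ∃ C : ℝ, ∀ ε d : ℝ, 0 < d → shortPot α ε d ≤ C * d⁻¹ ^ 4 := by
  refine ⟨2 / √Real.pi * (2 * ∫ t in Ioi α, t ^ (-4 : ℝ)), fun ε d hd => ?_⟩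
  rw [shortPot, mul_assoc]
  refine mul_le_mul_of_nonneg_left ?_ (by positivity)
  rw [mul_right_comm, ← integral_const_mul]
  have hint := (integrableOn_Ioi_rpow_of_lt (a := -4) (by norm_num) hα).const_mul (2 * d⁻¹ ^ 4)
  refine setIntegral_mono_on (integrableOn_mixture ε hd _) hint measurableSet_Ioi fun t ht => ?_
  have ht0 : 0 < t := hα.trans ht
  have h := Real.pow_div_factorial_le_exp (t ^ 2 * d ^ 2) (by positivity) 2
  rw [show (Nat.factorial 2 : ℝ) = 2 by norm_num [Nat.factorial]] at h
  refine (mixture_le ε d t).trans ?_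
  rw [neg_mul, Real.exp_neg, Real.rpow_neg ht0.le, show (4 : ℝ) = ((4 : ℕ) : ℝ) by norm_num,
    Real.rpow_natCast]
  calc (Real.exp (t ^ 2 * d ^ 2))⁻¹ ≤ ((t ^ 2 * d ^ 2) ^ 2 / 2)⁻¹ := by gcongr
    _ = 2 * d⁻¹ ^ 4 * (t ^ 4)⁻¹ := by field_simp

/-- Removing the screening under an integral of the mixture. -/
lemma tendsto_integral_mixture {s : Set ℝ}
    (hd : IntegrableOn (fun t => Real.exp (-t ^ 2 * d ^ 2)) s) :
    Tendsto (fun ε => ∫ t in s, mixture ε d t) (𝓝 0) (𝓝 (∫ t in s, mixture 0 d t)) := by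
  refine tendsto_integral_filter_of_dominated_convergence _
    (.of_forall fun ε => (measurable_mixture ε d).aestronglyMeasurable)
    (.of_forall fun ε => .of_forall fun t => ?_) hd (.of_forall fun t => ?_)
  · rw [Real.norm_of_nonneg (mixture_nonneg _ _ _)]
    exact mixture_le ε d t
  · have : Continuous fun ε => mixture ε d t := by unfold mixture; fun_prop
    exact this.tendsto 0

lemma tendsto_shortPot (hd : 0 < d) :
    Tendsto (fun ε => shortPot α ε d) (𝓝 0) (𝓝 (erfc (α * d) / d)) := by
  rw [← shortPot_zero hd]
  refine (tendsto_integral_mixture ?_).const_mul _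
  refine (integrableOn_mixture 0 hd _).congr (.of_forall fun t => ?_)
  simp [mixture]

lemma tendsto_longPot_self (hα : 0 < α) :
    Tendsto (fun ε => longPot α ε 0) (𝓝 0) (𝓝 (2 * α / √Real.pi)) := by
  have h := (tendsto_integral_mixture (d := 0) (s := Ioc 0 α)
    (by simp)).const_mul (2 / √Real.pi)
  have hval : ∫ t in Ioc 0 α, mixture 0 0 t = α := by simp [mixture, hα.le]
  rw [hval] at h
  rwa [mul_div_right_comm]

variable {l : Fin 3 → Space}

lemma summable_longPot (hl : LinearIndependent ℝ l) (hα : 0 < α) (hε : 0 < ε) (z : Space) :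
    Summable fun n : Fin 3 → ℤ => longPot α ε ‖z + comb l n‖ := by
  refine Summable.of_norm_bounded_eventually
    ((summable_inv_pow_four hl z).mul_left (6 / ε ^ 3)) ?_
  filter_upwards [(tendsto_norm_comb hl).eventually_gt_atTop ‖z‖] with n hn
  rw [Real.norm_of_nonneg longPot_nonneg]
  refine longPot_le hα hε (norm_pos_iff.mpr fun h => ?_)
  rw [eq_neg_of_add_eq_zero_right h, norm_neg] at hn
  exact lt_irrefl _ hn

/-- The term of the reciprocal lattice vector `G_m` in the Poisson sum of the long-range part of
the screened potential. The screening keeps it finite for `m = 0`. -/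
noncomputable def screenedRecip (l : Fin 3 → Space) (α ε : ℝ) (z : Space) (m : Fin 3 → ℤ) : ℝ :=
  4 * Real.pi / (cellVolume l * (‖comb (recip l) m‖ ^ 2 + ε ^ 2)) *
    Real.exp (-(‖comb (recip l) m‖ ^ 2 + ε ^ 2) / (4 * α ^ 2)) *
    Real.cos (inner ℝ (comb (recip l) m) z)

/-- Poisson summation of the long-range part, by integrating that of the Gaussians. -/
theorem hasSum_screenedRecip (hl : LinearIndependent ℝ l) (hα : 0 < α) (hε : 0 < ε) (z : Space) :
    HasSum (screenedRecip l α ε z) (∑' n : Fin 3 → ℤ, longPot α ε ‖z + comb l n‖) := by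
  have hV := cellVolume_pos hl
  have hπ := Real.sqrt_pos.mpr Real.pi_pos
  set μ := volume.restrict (Ioc 0 α) with hμ
  have hF (d : ℝ) : Integrable (mixture ε d) μ := by
    refine Measure.integrableOn_of_bounded (M := 1) (by simp)
      (measurable_mixture ε d).aestronglyMeasurable (.of_forall fun t => ?_)
    rw [Real.norm_of_nonneg (mixture_nonneg _ _ _)]
    refine (mixture_le ε d t).trans ?_
    rw [Real.exp_le_one_iff, neg_mul]
    exact neg_nonpos.mpr (by positivity)
  have hreal := hasSum_integral_of_summable_integral_norm (μ := μ)
    (F := fun n : Fin 3 → ℤ => mixture ε ‖z + comb l n‖) (fun n => hF _) (by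
      refine ((summable_longPot hl hα hε z).mul_left (√Real.pi / 2)).congr fun n => ?_
      simp_rw [Real.norm_of_nonneg (mixture_nonneg _ _ _)]
      rw [longPot, hμ]
      field_simp)
  let A : (Fin 3 → ℤ) → ℝ := fun m => ‖comb (recip l) m‖ ^ 2 + ε ^ 2
  have hA (m) : 0 < A m := by positivity
  let c : (Fin 3 → ℤ) → ℝ := fun m =>
    Real.pi ^ (3 / 2 : ℝ) / cellVolume l * Real.cos (inner ℝ (comb (recip l) m) z)
  have hc (m) : |c m| ≤ Real.pi ^ (3 / 2 : ℝ) / cellVolume l := by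
    rw [abs_mul, abs_of_pos (by positivity)]
    exact mul_le_of_le_one_right (by positivity) (Real.abs_cos_le_one _)
  let E : (Fin 3 → ℤ) → ℝ → ℝ := fun m t => (t ^ 3)⁻¹ * Real.exp (-A m / (4 * t ^ 2))
  have hE (m) : Integrable (E m) μ := (integral_inv_cube_mul_exp (hA m) hα).1
  have hEval (m) : ∫ t, E m t ∂μ = 2 / A m * Real.exp (-A m / (4 * α ^ 2)) :=
    (integral_inv_cube_mul_exp (hA m) hα).2
  have hEsum : Summable fun m => 2 / A m * Real.exp (-A m / (4 * α ^ 2)) := by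
    refine Summable.of_nonneg_of_le (fun m => by have := hA m; positivity) (fun m => ?_)
      ((summable_exp_neg_norm_sq (linearIndependent_recip hl)
        (c := 1 / (4 * α ^ 2)) (by positivity) 0).mul_left (2 / ε ^ 2))
    refine mul_le_mul ?_ (Real.exp_le_exp.mpr ?_) (Real.exp_pos _).le (by positivity)
    · gcongr
      exact le_add_of_nonneg_left (by positivity)
    · rw [zero_add, neg_mul, neg_div, neg_le_neg_iff, div_mul_eq_mul_div, one_mul]
      gcongr
      exact le_add_of_nonneg_right (by positivity)
  have hrecip := hasSum_integral_of_summable_integral_norm (μ := μ)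
    (F := fun m t => c m * E m t) (fun m => (hE m).const_mul _) (by
      refine Summable.of_nonneg_of_le (fun m => integral_nonneg fun _ => norm_nonneg _)
        (fun m => ?_) (hEsum.mul_left (Real.pi ^ (3 / 2 : ℝ) / cellVolume l))
      have : ∫ t, ‖c m * E m t‖ ∂μ = |c m| * ∫ t, E m t ∂μ := by
        rw [← integral_const_mul]
        refine setIntegral_congr_fun measurableSet_Ioc fun t ht => ?_
        have ht0 : 0 < t := ht.1
        simp only [norm_mul, Real.norm_eq_abs, E]
        rw [abs_of_pos (Real.exp_pos _), abs_of_pos (a := (t ^ 3)⁻¹) (by positivity)]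
      rw [this, hEval]
      exact mul_le_mul_of_nonneg_right (hc m) (by have := hA m; positivity))
  have heq : ∫ t, ∑' m, c m * E m t ∂μ = ∫ t, ∑' n, mixture ε ‖z + comb l n‖ t ∂μ := by
    refine setIntegral_congr_fun measurableSet_Ioc fun t ht => ?_
    have h := (hasSum_gaussian_comb hl ht.1 z).mul_right (Real.exp (-ε ^ 2 / (4 * t ^ 2)))
    rw [← tsum_mul_right] at h
    refine Eq.trans (tsum_congr fun m => ?_) h.tsum_eq
    simp only [c, E, A]
    rw [neg_add, add_div, Real.exp_add]
    have ht0 : t ≠ 0 := ht.1.ne'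
    field_simp
  rw [heq, ← hreal.tsum_eq] at hrecip
  have h := hrecip.mul_left (2 / √Real.pi)
  rw [← tsum_mul_left] at h
  refine h.congr_fun fun m => ?_
  rw [integral_const_mul, hEval]
  have hpow : Real.pi ^ (3 / 2 : ℝ) = Real.pi * √Real.pi := by
    rw [Real.sqrt_eq_rpow, show (3 / 2 : ℝ) = 1 + 1 / 2 by norm_num,
      Real.rpow_add Real.pi_pos, Real.rpow_one]
  simp only [c, hpow, screenedRecip]
  have := hA m
  change 4 * Real.pi / (cellVolume l * A m) * Real.exp (-A m / (4 * α ^ 2)) * _ = _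
  field_simp
  ring

end Splitting

/-! ### The Ewald form of the Abel sum -/

section AbelSum

variable {N : ℕ} {α ε : ℝ} {l : Fin 3 → Space} {r : Fin N → Space} {q : Fin N → ℝ}

lemma sep_eq (i j : Fin N) (n : Fin 3 → ℤ) : sep l r i j n = (r i - r j) + comb l n := by
  rw [sep]
  abel

/-- Only the excluded pairs are at distance zero. -/
lemma norm_sep_pos (hl : LinearIndependent ℝ l)
    (hr : ∀ i j, i ≠ j → ∀ n : Fin 3 → ℤ, sep l r i j n ≠ 0) {i j : Fin N} {n : Fin 3 → ℤ}
    (h : ¬(i = j ∧ n = 0)) : 0 < ‖sep l r i j n‖ := by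
  rw [norm_pos_iff]
  by_cases hij : i = j
  · subst hij
    rw [sep_eq, sub_self, zero_add]
    exact comb_ne_zero hl fun hn => h ⟨rfl, hn⟩
  · exact hr i j hij n

lemma norm_pairTerm_le (hl : LinearIndependent ℝ l)
    (hr : ∀ i j, i ≠ j → ∀ n : Fin 3 → ℤ, sep l r i j n ≠ 0) {v : ℝ → ℝ} {C : ℝ} (hC : 0 ≤ C)
    (hv : ∀ d, 0 < d → |v d| ≤ C * d⁻¹ ^ 4) (i j : Fin N) (n : Fin 3 → ℤ) :
    ‖pairTerm v q l r i j n‖ ≤ |q i * q j| * C * ‖(r i - r j) + comb l n‖⁻¹ ^ 4 := by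
  rw [pairTerm]
  split_ifs with h
  · rw [norm_zero]
    positivity
  · rw [Real.norm_eq_abs, abs_mul, mul_assoc, ← sep_eq]
    exact mul_le_mul_of_nonneg_left (hv _ (norm_sep_pos hl hr h)) (abs_nonneg _)

lemma summable_pairTerm (hl : LinearIndependent ℝ l)
    (hr : ∀ i j, i ≠ j → ∀ n : Fin 3 → ℤ, sep l r i j n ≠ 0) {v : ℝ → ℝ} {C : ℝ} (hC : 0 ≤ C)
    (hv : ∀ d, 0 < d → |v d| ≤ C * d⁻¹ ^ 4) (i j : Fin N) :
    Summable (pairTerm v q l r i j) :=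
  Summable.of_norm_bounded ((summable_inv_pow_four hl _).mul_left _)
    (norm_pairTerm_le hl hr hC hv i j)

lemma exists_abs_shortPot_le (hα : 0 < α) :
    ∃ C : ℝ, 0 ≤ C ∧ ∀ ε d : ℝ, 0 < d → |shortPot α ε d| ≤ C * d⁻¹ ^ 4 := by
  obtain ⟨C, hC⟩ := exists_shortPot_le hα
  refine ⟨C, ?_, fun ε d hd => ?_⟩
  · simpa using shortPot_nonneg.trans (hC 0 1 one_pos)
  · rw [abs_of_nonneg shortPot_nonneg]
    exact hC ε d hd

lemma summable_shortPot (hl : LinearIndependent ℝ l)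
    (hr : ∀ i j, i ≠ j → ∀ n : Fin 3 → ℤ, sep l r i j n ≠ 0) (hα : 0 < α) (ε : ℝ) (i j : Fin N) :
    Summable (pairTerm (shortPot α ε) q l r i j) := by
  obtain ⟨C, hC0, hC⟩ := exists_abs_shortPot_le hα
  exact summable_pairTerm hl hr hC0 (hC ε) i j

/-- On distances between distinct ions the short-range potential of the Ewald form is half the
unscreened `shortPot`. -/
lemma pairTerm_erfc (hl : LinearIndependent ℝ l)
    (hr : ∀ i j, i ≠ j → ∀ n : Fin 3 → ℤ, sep l r i j n ≠ 0) (i j : Fin N) (n : Fin 3 → ℤ) :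
    pairTerm (fun d => erfc (α * d) / (2 * d)) q l r i j n
      = 1 / 2 * pairTerm (shortPot α 0) q l r i j n := by
  simp only [pairTerm]
  split_ifs with h
  · simp
  · rw [shortPot_zero (norm_sep_pos hl hr h)]
    have := norm_sep_pos hl hr h
    field_simp

lemma summable_screened (hl : LinearIndependent ℝ l)
    (hr : ∀ i j, i ≠ j → ∀ n : Fin 3 → ℤ, sep l r i j n ≠ 0) (hε : 0 < ε) (i j : Fin N) :
    Summable (pairTerm (fun d => Real.exp (-ε * d) / d) q l r i j) := by
  refine summable_pairTerm hl hr (C := 6 / ε ^ 3) (by positivity) (fun d hd => ?_) i j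
  rw [abs_of_pos (by positivity)]
  exact screened_le hε hd

lemma norm_screenedRecip_le (hl : LinearIndependent ℝ l) {m : Fin 3 → ℤ} (hm : m ≠ 0) (z : Space) :
    ‖screenedRecip l α ε z m‖ ≤ 4 * Real.pi / (cellVolume l * ‖comb (recip l) m‖ ^ 2) *
      Real.exp (-‖comb (recip l) m‖ ^ 2 / (4 * α ^ 2)) := by
  have hG := norm_pos_iff.mpr (comb_ne_zero (linearIndependent_recip hl) hm)
  have hV := cellVolume_pos hl
  rw [screenedRecip, norm_mul, Real.norm_of_nonneg (by positivity)]
  refine (mul_le_of_le_one_right (by positivity) (Real.abs_cos_le_one _)).trans ?_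
  refine mul_le_mul ?_ (Real.exp_le_exp.mpr ?_) (Real.exp_pos _).le (by positivity)
  · gcongr
    exact le_add_of_nonneg_right (by positivity)
  · rw [neg_div, neg_div, neg_le_neg_iff]
    gcongr
    exact le_add_of_nonneg_right (by positivity)

lemma summable_recip_bound (hl : LinearIndependent ℝ l) (hα : 0 < α) :
    Summable fun m : Fin 3 → ℤ => 4 * Real.pi / (cellVolume l * ‖comb (recip l) m‖ ^ 2) *
      Real.exp (-‖comb (recip l) m‖ ^ 2 / (4 * α ^ 2)) := by
  have hk := linearIndependent_recip hl
  have hV := cellVolume_pos hl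
  refine Summable.of_norm_bounded_eventually ((summable_exp_neg_norm_sq hk
    (c := 1 / (4 * α ^ 2)) (by positivity) 0).mul_left (4 * Real.pi / cellVolume l)) ?_
  filter_upwards [(tendsto_norm_comb hk).eventually_ge_atTop 1] with m hm
  rw [Real.norm_of_nonneg (by positivity), zero_add]
  refine mul_le_mul ?_ (Real.exp_le_exp.mpr (le_of_eq (by ring))) (Real.exp_pos _).le
    (by positivity)
  gcongr
  exact le_mul_of_one_le_right hV.le (one_le_pow₀ hm)

/-- Twice the reciprocal-space term is the term of the Poisson sum without screening. -/
lemma two_mul_recipTerm (i j : Fin N) (m : Fin 3 → ℤ) :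
    2 * recipTerm α q l r i j m
      = if m = 0 then 0 else q i * q j * screenedRecip l α 0 (r i - r j) m := by
  simp only [recipTerm, screenedRecip]
  split_ifs
  · simp
  · simp only [ne_eq, OfNat.ofNat_ne_zero, not_false_eq_true, zero_pow, add_zero]
    ring

lemma norm_ite_screenedRecip_le (hl : LinearIndependent ℝ l) (i j : Fin N) (m : Fin 3 → ℤ) :
    ‖if m = 0 then 0 else q i * q j * screenedRecip l α ε (r i - r j) m‖
      ≤ |q i * q j| * (4 * Real.pi / (cellVolume l * ‖comb (recip l) m‖ ^ 2) *
        Real.exp (-‖comb (recip l) m‖ ^ 2 / (4 * α ^ 2))) := by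
  have hV := cellVolume_pos hl
  split_ifs with hm
  · rw [norm_zero]
    positivity
  · rw [norm_mul]
    exact mul_le_mul_of_nonneg_left (norm_screenedRecip_le hl hm _) (norm_nonneg _)

lemma summable_recipTerm (hl : LinearIndependent ℝ l) (hα : 0 < α) (i j : Fin N) :
    Summable (recipTerm α q l r i j) := by
  have h : Summable fun m => 2 * recipTerm α q l r i j m := by
    simp_rw [two_mul_recipTerm]
    exact Summable.of_norm_bounded ((summable_recip_bound hl hα).mul_left _)
      (norm_ite_screenedRecip_le hl i j)
  exact (summable_mul_left_iff two_ne_zero).mp h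

/-- The screened lattice sum of one pair of ions: the short-range part is summed directly, the
long-range part over the reciprocal lattice, where the image `n = 0` of an ion itself has to be
taken out again. -/
lemma tsum_screened (hl : LinearIndependent ℝ l)
    (hr : ∀ i j, i ≠ j → ∀ n : Fin 3 → ℤ, sep l r i j n ≠ 0) (hα : 0 < α) (hε : 0 < ε)
    (i j : Fin N) :
    ∑' n, pairTerm (fun d => Real.exp (-ε * d) / d) q l r i j n
      = ∑' n, pairTerm (shortPot α ε) q l r i j n
        + (q i * q j * screenedRecip l α ε 0 0
          + ∑' m, if m = 0 then 0 else q i * q j * screenedRecip l α ε (r i - r j) m)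
        - if i = j then q i * q j * longPot α ε 0 else 0 := by
  have hlong := ((summable_longPot hl hα hε (r i - r j)).mul_left (q i * q j)).hasSum
  have hself := hasSum_ite_eq (0 : Fin 3 → ℤ) (if i = j then q i * q j * longPot α ε 0 else 0)
  have h := ((summable_shortPot (q := q) hl hr hα ε i j).hasSum.add hlong).sub hself
  have hrec := hasSum_screenedRecip hl hα hε (r i - r j)
  have hrec0 := (hrec.summable.mul_left (q i * q j)).tsum_eq_add_tsum_ite 0
  rw [tsum_mul_left, hrec.tsum_eq, ← tsum_mul_left] at hrec0
  rw [hrec0] at h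
  have h00 : screenedRecip l α ε (r i - r j) 0 = screenedRecip l α ε 0 0 := by
    simp [screenedRecip]
  rw [h00] at h
  refine (h.congr_fun fun n => ?_).tsum_eq
  simp only [pairTerm, ← sep_eq]
  by_cases hn : n = 0
  · subst hn
    by_cases hij : i = j
    · subst hij
      simp [sep]
    · simp only [hij, false_and, if_false, if_true, sub_zero]
      rw [← mul_add, shortPot_add_longPot hα hε.le]
      exact norm_sep_pos hl hr fun h => hij h.1
  · simp only [hn, and_false, if_false, sub_zero]
    rw [← mul_add, shortPot_add_longPot hα hε.le]
    exact norm_sep_pos hl hr fun h => hn h.2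

lemma sum_sum_charge_mul (hq : ∑ i, q i = 0) (c : ℝ) : ∑ i, ∑ j, q i * q j * c = 0 := by
  simp_rw [← Finset.sum_mul, ← Finset.mul_sum, hq]
  simp

/-- In a neutral cell the reciprocal vector `m = 0` drops out of the screened energy. -/
lemma abelCoulomb_eq (hl : LinearIndependent ℝ l)
    (hr : ∀ i j, i ≠ j → ∀ n : Fin 3 → ℤ, sep l r i j n ≠ 0) (hq : ∑ i, q i = 0) (hα : 0 < α)
    (hε : 0 < ε) (ke : ℝ) :
    abelCoulomb ke q l r ε = ke / 2 *
      (∑ i, ∑ j, (∑' n, pairTerm (shortPot α ε) q l r i j n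
        + ∑' m, if m = 0 then 0 else q i * q j * screenedRecip l α ε (r i - r j) m)
        - (∑ i, q i ^ 2) * longPot α ε 0) := by
  rw [abelCoulomb]
  congr 1
  simp_rw [tsum_screened hl hr hα hε, Finset.sum_sub_distrib, Finset.sum_add_distrib,
    sum_sum_charge_mul hq, Finset.sum_ite_eq, Finset.sum_mul]
  simp [sq]

/-- The Abel sum of the Coulomb series is the Ewald form. -/
theorem tendsto_abelCoulomb (hl : LinearIndependent ℝ l)
    (hr : ∀ i j, i ≠ j → ∀ n : Fin 3 → ℤ, sep l r i j n ≠ 0) (hq : ∑ i, q i = 0) (hα : 0 < α)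
    (ke : ℝ) :
    Tendsto (abelCoulomb ke q l r) (𝓝[>] 0)
      (𝓝 (shortEnergy ke α q l r + longEnergy ke α q l r + selfEnergy ke α q)) := by
  have hle : 𝓝[>] (0 : ℝ) ≤ 𝓝 0 := nhdsWithin_le_nhds
  have hV := cellVolume_pos hl
  obtain ⟨C, hC0, hC⟩ := exists_abs_shortPot_le hα
  have hshort (i j : Fin N) :
      Tendsto (fun ε => ∑' n, pairTerm (shortPot α ε) q l r i j n) (𝓝[>] 0)
        (𝓝 (∑' n, pairTerm (shortPot α 0) q l r i j n)) := by
    refine tendsto_tsum_of_dominated_convergence ((summable_inv_pow_four hl _).mul_left _)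
      (fun n => ?_) (.of_forall fun ε => norm_pairTerm_le hl hr hC0 (hC ε) i j)
    simp only [pairTerm]
    split_ifs with h
    · exact tendsto_const_nhds
    · have hd := norm_sep_pos hl hr h
      rw [shortPot_zero hd]
      exact ((tendsto_shortPot hd).mono_left hle).const_mul _
  have hrec (i j : Fin N) :
      Tendsto (fun ε => ∑' m, if m = 0 then 0 else q i * q j * screenedRecip l α ε (r i - r j) m)
        (𝓝[>] 0)
        (𝓝 (∑' m, if m = 0 then 0 else q i * q j * screenedRecip l α 0 (r i - r j) m)) := by
    refine tendsto_tsum_of_dominated_convergence ((summable_recip_bound hl hα).mul_left _)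
      (fun m => ?_) (.of_forall fun ε => norm_ite_screenedRecip_le hl i j)
    split_ifs with hm
    · exact tendsto_const_nhds
    · have hG := norm_pos_iff.mpr (comb_ne_zero (linearIndependent_recip hl) hm)
      have hcont : Continuous fun ε => screenedRecip l α ε (r i - r j) m := by
        unfold screenedRecip
        have (ε : ℝ) : cellVolume l * (‖comb (recip l) m‖ ^ 2 + ε ^ 2) ≠ 0 := by positivity
        fun_prop (disch := exact this _)
      exact ((hcont.tendsto 0).mono_left hle).const_mul _
  have h := ((tendsto_finsetSum Finset.univ fun i _ => tendsto_finsetSum Finset.univ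
    fun j _ => (hshort i j).add (hrec i j)).sub
      (((tendsto_longPot_self hα).mono_left hle).const_mul (∑ i, q i ^ 2))).const_mul (ke / 2)
  have hval : shortEnergy ke α q l r + longEnergy ke α q l r + selfEnergy ke α q
      = ke / 2 * (∑ i, ∑ j, (∑' n, pairTerm (shortPot α 0) q l r i j n
        + ∑' m, if m = 0 then 0 else q i * q j * screenedRecip l α 0 (r i - r j) m)
        - (∑ i, q i ^ 2) * (2 * α / √Real.pi)) := by
    simp only [shortEnergy, longEnergy, selfEnergy, pairTerm_erfc hl hr, ← two_mul_recipTerm,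
      tsum_mul_left, Finset.sum_add_distrib, ← Finset.mul_sum, ← Finset.sum_mul]
    ring
  rw [hval]
  refine h.congr' ?_
  filter_upwards [self_mem_nhdsWithin] with ε hε
  exact (abelCoulomb_eq hl hr hq hα hε ke).symm

end AbelSum

/-! ### The unscreened series of a cell without dipole moment -/

section Dipole

variable {N : ℕ} {l : Fin 3 → Space} {r : Fin N → Space} {q : Fin N → ℝ}

lemma sum_sum_charge_mul_left (hq : ∑ i, q i = 0) (A : Fin N → ℝ) :
    ∑ i, ∑ j, q i * q j * A i = 0 := by
  refine Finset.sum_eq_zero fun i _ => ?_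
  rw [← Finset.sum_mul, ← Finset.mul_sum, hq]
  ring

lemma sum_sum_charge_mul_right (hq : ∑ i, q i = 0) (A : Fin N → ℝ) :
    ∑ i, ∑ j, q i * q j * A j = 0 := by
  rw [Finset.sum_comm, ← sum_sum_charge_mul_left hq A]
  refine Finset.sum_congr rfl fun i _ => Finset.sum_congr rfl fun j _ => ?_
  ring

lemma sum_sum_charge_mul_inner (hr0 : ∑ i, q i • r i = 0) :
    ∑ i, ∑ j, q i * q j * inner ℝ (r i) (r j) = 0 := by
  have h : inner ℝ (∑ i, q i • r i) (∑ j, q j • r j) = 0 := by rw [hr0, inner_zero_left]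
  rw [← h]
  simp only [sum_inner, inner_sum, inner_smul_left, inner_smul_right, conj_trivial, Finset.mul_sum]
  refine Finset.sum_congr rfl fun i _ => Finset.sum_congr rfl fun j _ => ?_
  rw [real_inner_comm]
  ring

lemma sum_sum_charge_mul_inner_mul (hr0 : ∑ i, q i • r i = 0) (L : Space) :
    ∑ i, ∑ j, q i * q j * (inner ℝ L (r i) * inner ℝ L (r j)) = 0 := by
  have h : inner ℝ L (∑ i, q i • r i) * inner ℝ L (∑ j, q j • r j) = 0 := by
    rw [hr0, inner_zero_right, zero_mul]
  rw [← h]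
  simp only [inner_sum, inner_smul_right, Finset.sum_mul_sum]
  refine Finset.sum_congr rfl fun i _ => Finset.sum_congr rfl fun j _ => ?_
  ring

/-- Without charge and dipole moment, the terms of first order in `‖L + a‖² - ‖L‖²` cancel. -/
lemma sum_sum_charge_mul_shift (hq : ∑ i, q i = 0) (hr0 : ∑ i, q i • r i = 0) (L : Space) :
    ∑ i, ∑ j, q i * q j * (2 * inner ℝ L (r i - r j) + ‖r i - r j‖ ^ 2) = 0 := by
  have h1 := sum_sum_charge_mul_left hq fun i => 2 * inner ℝ L (r i) + ‖r i‖ ^ 2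
  have h2 := sum_sum_charge_mul_right hq fun i => -2 * inner ℝ L (r i) + ‖r i‖ ^ 2
  have h3 := sum_sum_charge_mul_inner hr0
  calc _ = ∑ i, ∑ j, (q i * q j * (2 * inner ℝ L (r i) + ‖r i‖ ^ 2)
        + q i * q j * (-2 * inner ℝ L (r j) + ‖r j‖ ^ 2)
        - 2 * (q i * q j * inner ℝ (r i) (r j))) := by
        refine Finset.sum_congr rfl fun i _ => Finset.sum_congr rfl fun j _ => ?_
        rw [inner_sub_right, norm_sub_sq_real]
        ring
    _ = 0 := by
        simp only [Finset.sum_sub_distrib, Finset.sum_add_distrib, ← Finset.mul_sum, h1, h2, h3]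
        ring

/-- Without charge and dipole moment, the leading terms of second order in `‖L + a‖² - ‖L‖²`
cancel as well. -/
lemma sum_sum_charge_mul_inner_sq (hq : ∑ i, q i = 0) (hr0 : ∑ i, q i • r i = 0) (L : Space) :
    ∑ i, ∑ j, q i * q j * inner ℝ L (r i - r j) ^ 2 = 0 := by
  have h1 := sum_sum_charge_mul_left hq fun i => inner ℝ L (r i) ^ 2
  have h2 := sum_sum_charge_mul_right hq fun i => inner ℝ L (r i) ^ 2
  have h3 := sum_sum_charge_mul_inner_mul hr0 L
  calc _ = ∑ i, ∑ j, (q i * q j * inner ℝ L (r i) ^ 2 + q i * q j * inner ℝ L (r j) ^ 2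
        - 2 * (q i * q j * (inner ℝ L (r i) * inner ℝ L (r j)))) := by
        refine Finset.sum_congr rfl fun i _ => Finset.sum_congr rfl fun j _ => ?_
        rw [inner_sub_right]
        ring
    _ = 0 := by
        simp only [Finset.sum_sub_distrib, Finset.sum_add_distrib, ← Finset.mul_sum, h1, h2, h3]
        ring

/-- The second-order Taylor estimate of the exponential function with an explicit remainder. -/
lemma abs_exp_sub_le (x : ℝ) : |Real.exp x - (1 + x + x ^ 2 / 2)| ≤ |x| ^ 3 * Real.exp |x| := by
  have h := Complex.norm_exp_sub_sum_le_norm_mul_exp (x : ℂ) 3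
  have e : Complex.exp x - ∑ m ∈ Finset.range 3, (x : ℂ) ^ m / (m.factorial : ℂ)
      = ((Real.exp x - (1 + x + x ^ 2 / 2) : ℝ) : ℂ) := by
    simp [Finset.sum_range_succ, Nat.factorial]
  rwa [e, Complex.norm_real, Complex.norm_real] at h

/-- The Gaussian potential of a cell without charge and dipole moment in a distant cell. Expanding
the exponential to second order in `‖L + a‖² - ‖L‖²`, of order `‖L‖`, leaves a remainder that is
smaller than the Gaussian itself by the factor `‖L‖⁻³` when `x` is of the order `‖L‖⁻²`. -/
lemma abs_sum_sum_gaussian_le (hq : ∑ i, q i = 0) (hr0 : ∑ i, q i • r i = 0) {D : ℝ}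
    (hD : ∀ i j, ‖r i - r j‖ ≤ D) (hD0 : 0 < D) {L : Space} (hL : 6 * D ≤ ‖L‖) {x : ℝ}
    (hx : 0 ≤ x) :
    |∑ i, ∑ j, q i * q j * Real.exp (-x * ‖(r i - r j) + L‖ ^ 2)|
      ≤ (∑ i, ∑ j, |q i * q j|) * D ^ 3 *
        (Real.exp (-(x * ‖L‖ ^ 2) / 2) * (3 * x ^ 2 * ‖L‖ + 27 * x ^ 3 * ‖L‖ ^ 3)) := by
  let w : Fin N → Fin N → ℝ := fun i j => 2 * inner ℝ L (r i - r j) + ‖r i - r j‖ ^ 2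
  let u : Fin N → Fin N → ℝ := fun i j =>
    4 * inner ℝ L (r i - r j) * ‖r i - r j‖ ^ 2 + ‖r i - r j‖ ^ 4
  have hin (i j) : |inner ℝ L (r i - r j)| ≤ ‖L‖ * D :=
    (abs_real_inner_le_norm _ _).trans (mul_le_mul_of_nonneg_left (hD i j) (norm_nonneg _))
  have hw (i j) : |w i j| ≤ 3 * D * ‖L‖ := by
    have h1 := pow_le_pow_left₀ (norm_nonneg _) (hD i j) 2
    have h2 : D ^ 2 ≤ D * ‖L‖ := by nlinarith
    calc |w i j| ≤ 2 * |inner ℝ L (r i - r j)| + ‖r i - r j‖ ^ 2 := by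
          refine (abs_add_le _ _).trans (le_of_eq ?_)
          rw [abs_mul, abs_two, abs_of_nonneg (a := ‖r i - r j‖ ^ 2) (by positivity)]
      _ ≤ 3 * D * ‖L‖ := by linarith [hin i j]
  -- The lower bound of `‖L‖` makes half of the Gaussian exponent absorb the remainder's growth.
  have hw' (i j) : |w i j| ≤ ‖L‖ ^ 2 / 2 := (hw i j).trans (by nlinarith [norm_nonneg L])
  have hu (i j) : |u i j| ≤ 6 * D ^ 3 * ‖L‖ := by
    have h1 := pow_le_pow_left₀ (norm_nonneg _) (hD i j) 2
    have h2 := pow_le_pow_left₀ (norm_nonneg _) (hD i j) 4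
    have h3 : D ^ 4 ≤ D ^ 3 * ‖L‖ := by
      rw [pow_succ D 3]
      exact mul_le_mul_of_nonneg_left (by linarith) (by positivity)
    calc |u i j| ≤ 4 * (|inner ℝ L (r i - r j)| * ‖r i - r j‖ ^ 2) + ‖r i - r j‖ ^ 4 := by
          refine (abs_add_le _ _).trans (le_of_eq ?_)
          rw [abs_mul, abs_mul, abs_of_nonneg (a := ‖r i - r j‖ ^ 4) (by positivity),
            abs_of_nonneg (a := ‖r i - r j‖ ^ 2) (by positivity), abs_of_pos four_pos]
          ring
      _ ≤ 4 * (‖L‖ * D * D ^ 2) + D ^ 4 := by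
          have := mul_le_mul (hin i j) h1 (by positivity) (by positivity)
          linarith
      _ ≤ 6 * D ^ 3 * ‖L‖ := by
          have : 0 ≤ D ^ 3 * ‖L‖ := by positivity
          linarith
  have hnorm (i j) : ‖(r i - r j) + L‖ ^ 2 = ‖L‖ ^ 2 + w i j := by
    rw [norm_add_sq_real, real_inner_comm]
    ring
  let R : Fin N → Fin N → ℝ := fun i j =>
    Real.exp (-x * w i j) - (1 + -x * w i j + (-x * w i j) ^ 2 / 2)
  have hR (i j) : |R i j| ≤ 27 * x ^ 3 * D ^ 3 * ‖L‖ ^ 3 * Real.exp (x * ‖L‖ ^ 2 / 2) := by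
    have e : |-x * w i j| = x * |w i j| := by rw [abs_mul, abs_neg, abs_of_nonneg hx]
    refine (abs_exp_sub_le _).trans ?_
    rw [e]
    calc (x * |w i j|) ^ 3 * Real.exp (x * |w i j|)
        ≤ (x * (3 * D * ‖L‖)) ^ 3 * Real.exp (x * (‖L‖ ^ 2 / 2)) := by
          gcongr
          · exact hw i j
          · exact hw' i j
      _ = _ := by ring_nf
  have hsum : ∑ i, ∑ j, q i * q j * Real.exp (-x * ‖(r i - r j) + L‖ ^ 2)
      = Real.exp (-(x * ‖L‖ ^ 2)) * ∑ i, ∑ j, q i * q j * (x ^ 2 / 2 * u i j + R i j) := by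
    have h0 := sum_sum_charge_mul hq 1
    have h1 := sum_sum_charge_mul_shift hq hr0 L
    have h2 := sum_sum_charge_mul_inner_sq hq hr0 L
    have h3 : ∑ i, ∑ j, q i * q j * Real.exp (-x * w i j)
        = ∑ i, ∑ j, q i * q j * (x ^ 2 / 2 * u i j + R i j) := by
      calc _ = ∑ i, ∑ j, (q i * q j * (x ^ 2 / 2 * u i j + R i j) + q i * q j * 1
            - x * (q i * q j * (2 * inner ℝ L (r i - r j) + ‖r i - r j‖ ^ 2))
            + 2 * x ^ 2 * (q i * q j * inner ℝ L (r i - r j) ^ 2)) := by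
            refine Finset.sum_congr rfl fun i _ => Finset.sum_congr rfl fun j _ => ?_
            simp only [R, u, w]
            ring
        _ = _ := by
            simp only [Finset.sum_sub_distrib, Finset.sum_add_distrib, ← Finset.mul_sum, h0, h1,
              h2]
            ring
    rw [← h3, Finset.mul_sum]
    refine Finset.sum_congr rfl fun i _ => ?_
    rw [Finset.mul_sum]
    refine Finset.sum_congr rfl fun j _ => ?_
    rw [hnorm, mul_left_comm, ← Real.exp_add]
    ring_nf
  have hpair (i j) : |q i * q j * (x ^ 2 / 2 * u i j + R i j)| ≤ |q i * q j| *
      (3 * x ^ 2 * D ^ 3 * ‖L‖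
        + 27 * x ^ 3 * D ^ 3 * ‖L‖ ^ 3) * Real.exp (x * ‖L‖ ^ 2 / 2) := by
    rw [abs_mul, mul_assoc]
    refine mul_le_mul_of_nonneg_left ?_ (abs_nonneg _)
    have he : 1 ≤ Real.exp (x * ‖L‖ ^ 2 / 2) := Real.one_le_exp (by positivity)
    have h1 : |x ^ 2 / 2 * u i j| ≤ 3 * x ^ 2 * D ^ 3 * ‖L‖ * Real.exp (x * ‖L‖ ^ 2 / 2) := by
      rw [abs_mul, abs_of_nonneg (a := x ^ 2 / 2) (by positivity)]
      calc x ^ 2 / 2 * |u i j| ≤ x ^ 2 / 2 * (6 * D ^ 3 * ‖L‖) := by gcongr; exact hu i j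
        _ = 3 * x ^ 2 * D ^ 3 * ‖L‖ * 1 := by ring
        _ ≤ _ := by gcongr
    rw [add_mul]
    exact (abs_add_le _ _).trans (add_le_add h1 (hR i j))
  rw [hsum, abs_mul, abs_of_pos (Real.exp_pos _)]
  calc _ ≤ Real.exp (-(x * ‖L‖ ^ 2)) * ∑ i, ∑ j, |q i * q j| *
      (3 * x ^ 2 * D ^ 3 * ‖L‖
        + 27 * x ^ 3 * D ^ 3 * ‖L‖ ^ 3) * Real.exp (x * ‖L‖ ^ 2 / 2) := by
        refine mul_le_mul_of_nonneg_left ?_ (Real.exp_pos _).le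
        refine (Finset.abs_sum_le_sum_abs _ _).trans (Finset.sum_le_sum fun i _ => ?_)
        exact (Finset.abs_sum_le_sum_abs _ _).trans (Finset.sum_le_sum fun j _ => hpair i j)
    _ = _ := by
        have he : Real.exp (-(x * ‖L‖ ^ 2) / 2)
            = Real.exp (-(x * ‖L‖ ^ 2)) * Real.exp (x * ‖L‖ ^ 2 / 2) := by
          rw [← Real.exp_add]
          ring_nf
        simp only [← Finset.sum_mul]
        rw [he]
        ring

/-- A bound for the interaction with the cell `n`, without the factor `k_e / 2`, that holds whatever
the screening: in the mixture of Gaussians the weight is dropped, and the absolute value is taken of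
the Gaussian interaction summed over all pairs, so that the cancellation in the cell is kept. -/
noncomputable def cellBound (q : Fin N → ℝ) (l : Fin 3 → Space) (r : Fin N → Space)
    (n : Fin 3 → ℤ) : ℝ :=
  2 / √Real.pi * ∫ t in Ioi 0, |∑ i, ∑ j, pairTerm (fun d => mixture 0 d t) q l r i j n|

lemma integrableOn_pairTerm_mixture (hl : LinearIndependent ℝ l)
    (hr : ∀ i j, i ≠ j → ∀ n : Fin 3 → ℤ, sep l r i j n ≠ 0) (ε : ℝ) (i j : Fin N)
    (n : Fin 3 → ℤ) (s : Set ℝ) :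
    IntegrableOn (fun t => pairTerm (fun d => mixture ε d t) q l r i j n) s := by
  simp only [pairTerm]
  split_ifs with h
  · exact integrableOn_zero
  · exact (integrableOn_mixture ε (norm_sep_pos hl hr h) s).const_mul _

lemma pairTerm_screened_eq_integral (hl : LinearIndependent ℝ l)
    (hr : ∀ i j, i ≠ j → ∀ n : Fin 3 → ℤ, sep l r i j n ≠ 0) {ε : ℝ} (hε : 0 ≤ ε) (i j : Fin N)
    (n : Fin 3 → ℤ) :
    pairTerm (fun d => Real.exp (-ε * d) / d) q l r i j n
      = 2 / √Real.pi * ∫ t in Ioi 0, pairTerm (fun d => mixture ε d t) q l r i j n := by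
  simp only [pairTerm]
  split_ifs with h
  · simp
  · rw [integral_const_mul, mul_left_comm, integral_mixture hε (norm_sep_pos hl hr h)]

lemma abs_sum_sum_screened_le (hl : LinearIndependent ℝ l)
    (hr : ∀ i j, i ≠ j → ∀ n : Fin 3 → ℤ, sep l r i j n ≠ 0) {ε : ℝ} (hε : 0 ≤ ε)
    (n : Fin 3 → ℤ) :
    |∑ i, ∑ j, pairTerm (fun d => Real.exp (-ε * d) / d) q l r i j n| ≤ cellBound q l r n := by
  simp only [pairTerm_screened_eq_integral hl hr hε, ← Finset.mul_sum]
  have hint := integrableOn_pairTerm_mixture (q := q) hl hr ε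
  have hsum : ∑ i, ∑ j, ∫ t in Ioi 0, pairTerm (fun d => mixture ε d t) q l r i j n
      = ∫ t in Ioi 0, ∑ i, ∑ j, pairTerm (fun d => mixture ε d t) q l r i j n := by
    rw [integral_finsetSum _ fun i _ => integrable_finsetSum _ fun j _ => hint i j n _]
    exact Finset.sum_congr rfl fun i _ => (integral_finsetSum _ fun j _ => hint i j n _).symm
  rw [hsum, abs_mul, abs_of_pos (by positivity), cellBound]
  refine mul_le_mul_of_nonneg_left ?_ (by positivity)
  rw [← Real.norm_eq_abs]
  refine norm_integral_le_of_norm_le ((integrable_finsetSum _ fun i _ => integrable_finsetSum _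
    fun j _ => integrableOn_pairTerm_mixture hl hr 0 i j n _).abs) (.of_forall fun t => ?_)
  have h (i j : Fin N) : pairTerm (fun d => mixture ε d t) q l r i j n
      = pairTerm (fun d => mixture 0 d t) q l r i j n * Real.exp (-ε ^ 2 / (4 * t ^ 2)) := by
    simp only [pairTerm]
    split_ifs
    · simp
    · simp [mixture, mul_assoc]
  simp only [h, ← Finset.sum_mul]
  rw [norm_mul, Real.norm_of_nonneg (Real.exp_pos _).le]
  exact mul_le_of_le_one_right (norm_nonneg _) (exp_neg_div_le_one ε t)

/-- The interaction energies of a cell without charge and dipole moment with its images are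
absolutely summable, uniformly in the screening. They are of the order `‖L_n‖⁻⁴`. -/
lemma summable_cellBound (hl : LinearIndependent ℝ l)
    (hr : ∀ i j, i ≠ j → ∀ n : Fin 3 → ℤ, sep l r i j n ≠ 0) (hq : ∑ i, q i = 0)
    (hr0 : ∑ i, q i • r i = 0) : Summable (cellBound q l r) := by
  obtain ⟨D, hD0, hD⟩ : ∃ D : ℝ, 0 < D ∧ ∀ i j, ‖r i - r j‖ ≤ D := by
    refine ⟨1 + ∑ i, ∑ j, ‖r i - r j‖, by positivity, fun i j => ?_⟩
    have h1 := Finset.single_le_sum (f := fun j => ‖r i - r j‖) (fun _ _ => norm_nonneg _)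
      (Finset.mem_univ j)
    have h2 := Finset.single_le_sum (f := fun i => ∑ j, ‖r i - r j‖)
      (fun _ _ => Finset.sum_nonneg fun _ _ => norm_nonneg _) (Finset.mem_univ i)
    linarith
  -- The substitution `u = ‖L_n‖ t` turns the bound of the Gaussians into `‖L_n‖⁻³ g(u)`, and the
  -- measure `dt` gives the fourth power.
  let g : ℝ → ℝ := fun u => (∑ i, ∑ j, |q i * q j|) * D ^ 3 *
    (3 * (u ^ (4 : ℝ) * Real.exp (-(1 / 2) * u ^ 2))
      + 27 * (u ^ (6 : ℝ) * Real.exp (-(1 / 2) * u ^ 2)))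
  have hg : Integrable g :=
    (((integrable_rpow_mul_exp_neg_mul_sq (by norm_num) (by norm_num)).const_mul 3).add
      ((integrable_rpow_mul_exp_neg_mul_sq (by norm_num) (by norm_num)).const_mul 27)).const_mul _
  refine Summable.of_norm_bounded_eventually
    ((summable_inv_pow_four hl 0).mul_left (2 / √Real.pi * ∫ u in Ioi 0, g u)) ?_
  have hne : ∀ᶠ n : Fin 3 → ℤ in cofinite, n ≠ 0 := by simp [Filter.eventually_cofinite]
  filter_upwards [hne, (tendsto_norm_comb hl).eventually_ge_atTop (6 * D)] with n hn hL
  have hL0 : 0 < ‖comb l n‖ := by linarith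
  have hscale := integral_comp_mul_left_Ioi g 0 hL0
  rw [mul_zero, smul_eq_mul] at hscale
  have hbound (t : ℝ) : |∑ i, ∑ j, pairTerm (fun d => mixture 0 d t) q l r i j n|
      ≤ ‖comb l n‖⁻¹ ^ 3 * g (‖comb l n‖ * t) := by
    have h := abs_sum_sum_gaussian_le hq hr0 hD hD0 hL (sq_nonneg t)
    simp only [pairTerm, hn, and_false, if_false, mixture, sep_eq]
    simp only [ne_eq, OfNat.ofNat_ne_zero, not_false_eq_true, zero_pow, neg_zero, zero_div,
      Real.exp_zero, mul_one]
    refine h.trans (le_of_eq ?_)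
    have e4 (u : ℝ) : u ^ (4 : ℝ) = u ^ 4 := by exact_mod_cast Real.rpow_natCast u 4
    have e6 (u : ℝ) : u ^ (6 : ℝ) = u ^ 6 := by exact_mod_cast Real.rpow_natCast u 6
    have ee : -(t ^ 2 * ‖comb l n‖ ^ 2) / 2 = -(1 / 2) * (‖comb l n‖ * t) ^ 2 := by ring
    simp only [g, e4, e6, ee]
    field_simp
  have hnn : 0 ≤ cellBound q l r n :=
    mul_nonneg (by positivity) (integral_nonneg fun _ => abs_nonneg _)
  rw [Real.norm_of_nonneg hnn, zero_add, cellBound, mul_assoc]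
  refine mul_le_mul_of_nonneg_left ?_ (by positivity)
  calc _ ≤ ∫ t in Ioi 0, ‖comb l n‖⁻¹ ^ 3 * g (‖comb l n‖ * t) := by
        refine integral_mono ((integrable_finsetSum _ fun i _ => integrable_finsetSum _
          fun j _ => integrableOn_pairTerm_mixture hl hr 0 i j n _).abs) ?_ hbound
        exact ((hg.comp_mul_left' hL0.ne').const_mul _).integrableOn
    _ = _ := by
        rw [integral_const_mul, hscale]
        ring

/-- Without dipole moment the sum over cells may be exchanged with the limit of the screening. -/
theorem hasSum_cellCoulomb (hl : LinearIndependent ℝ l)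
    (hr : ∀ i j, i ≠ j → ∀ n : Fin 3 → ℤ, sep l r i j n ≠ 0) (hq : ∑ i, q i = 0)
    (hr0 : ∑ i, q i • r i = 0) {ke Φ : ℝ} (hΦ : Tendsto (abelCoulomb ke q l r) (𝓝[>] 0) (𝓝 Φ)) :
    HasSum (cellCoulomb ke q l r) Φ := by
  have hb := (summable_cellBound hl hr hq hr0).mul_left |ke / 2|
  let cell : ℝ → (Fin 3 → ℤ) → ℝ := fun ε n =>
    ke / 2 * ∑ i, ∑ j, pairTerm (fun d => Real.exp (-ε * d) / d) q l r i j n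
  have hle (ε : ℝ) (hε : 0 ≤ ε) (n) : ‖cell ε n‖ ≤ |ke / 2| * cellBound q l r n := by
    rw [Real.norm_eq_abs, abs_mul]
    exact mul_le_mul_of_nonneg_left (abs_sum_sum_screened_le hl hr hε n) (abs_nonneg _)
  have hcell0 : cell 0 = cellCoulomb ke q l r := by
    ext n
    simp [cell, cellCoulomb]
  have hlim : Tendsto (fun ε => ∑' n, cell ε n) (𝓝[>] 0) (𝓝 (∑' n, cell 0 n)) := by
    refine tendsto_tsum_of_dominated_convergence hb (fun n => ?_) ?_
    · have hcont : Continuous fun ε => cell ε n := by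
        simp only [cell, pairTerm]
        refine continuous_const.mul (continuous_finsetSum _ fun i _ => continuous_finsetSum _
          fun j _ => ?_)
        split_ifs
        · exact continuous_const
        · fun_prop
      exact (hcont.tendsto 0).mono_left nhdsWithin_le_nhds
    · filter_upwards [self_mem_nhdsWithin] with ε hε using hle ε (le_of_lt hε)
  have habel : abelCoulomb ke q l r =ᶠ[𝓝[>] 0] fun ε => ∑' n, cell ε n := by
    filter_upwards [self_mem_nhdsWithin] with ε hε
    have hs := summable_screened (q := q) hl hr hε
    simp only [abelCoulomb, cell]
    rw [tsum_mul_left, Summable.tsum_finsetSum fun i _ => summable_sum fun j _ => hs i j]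
    congr 1
    refine Finset.sum_congr rfl fun i _ => ?_
    exact (Summable.tsum_finsetSum fun j _ => hs i j).symm
  rw [tendsto_nhds_unique (hΦ.congr' habel) hlim, ← hcell0]
  exact (Summable.of_norm_bounded hb (hle 0 le_rfl)).hasSum

end Dipole

end Ewald

theorem mainTheorem1 {N : ℕ} (ke α : ℝ) (hα : 0 < α)
    (l : Fin 3 → Ewald.Space) (hl : LinearIndependent ℝ l)
    (r : Fin N → Ewald.Space)
    (hr : ∀ i j, i ≠ j → ∀ n : Fin 3 → ℤ, Ewald.sep l r i j n ≠ 0)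
    (q : Fin N → ℝ) (hq : ∑ i, q i = 0) :
    -- both parts of the Ewald form are absolutely convergent
    (∀ i j, Summable (Ewald.pairTerm (fun d => Ewald.erfc (α * d) / (2 * d)) q l r i j)) ∧
    (∀ i j, Summable (Ewald.recipTerm α q l r i j)) ∧
    -- the Coulomb series has a value
    (∀ ε > 0, ∀ i j, Summable (Ewald.pairTerm (fun d => Real.exp (-ε * d) / d) q l r i j)) ∧
    Tendsto (Ewald.abelCoulomb ke q l r) (𝓝[>] 0) (𝓝 (Ewald.coulombEnergy ke q l r)) ∧
    -- which is the value of the Ewald form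
    Ewald.coulombEnergy ke q l r =
      Ewald.shortEnergy ke α q l r + Ewald.longEnergy ke α q l r + Ewald.selfEnergy ke α q ∧
    -- and the unregularised sum over unit cell images when the cell has no dipole moment
    (∑ i, q i • r i = 0 →
      HasSum (Ewald.cellCoulomb ke q l r) (Ewald.coulombEnergy ke q l r)) := by
  have hlim := Ewald.tendsto_abelCoulomb hl hr hq hα ke
  have hval : Ewald.coulombEnergy ke q l r = _ := hlim.limUnder_eq
  refine ⟨fun i j => ?_, Ewald.summable_recipTerm hl hα,
    fun ε hε => Ewald.summable_screened hl hr hε, hval ▸ hlim, hval,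
    fun hr0 => Ewald.hasSum_cellCoulomb hl hr hq hr0 (hval ▸ hlim)⟩
  exact ((Ewald.summable_shortPot hl hr hα 0 i j).mul_left (1 / 2)).congr
    fun n => (Ewald.pairTerm_erfc hl hr i j n).symm
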